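/- Let $a<b$ be real numbers, $\Omega=(a,b)$, $1\le p<\infty$, and let $(\epsilon_n)$ be a sequence of positive reals with $\epsilon_n\to 0$. For $\epsilon>0$ define $F_\epsilon:L^p(\Omega)\to[-\infty,\infty]$ by $$F_\epsilon(u)=\int_\Omega \epsilon^{-1}(u^2-1)^2+\epsilon^3|u''|^2\,dx\ \text{ if } u\in W^{2,p}(\Omega),\qquad F_\epsilon(u)=+\infty\ \text{ otherwise,}$$ where $u''$ is the weak second derivative (the integral may be $+\infty$, and no boundary conditions are imposed). Let $$\mathscr J=\{u\in W^{2,p}(0,1): u(0_+)=-1,\ u(1_-)=1,\ u'(0_+)=u'(1_-)=0\},$$ where one-sided limits are those of the $C^1$ representative of $u$ and of its derivative, and let $$\Phi(u)=\Big(\int_0^1(u^2-1)^2\,dy\Big)^{3/4}\Big(\int_0^1|u''|^2\,dy\Big)^{1/4},\qquad \alpha=\frac{2}{3^{3/4}}\inf_{u\in\mathscr J}\Phi(u).$$ For $u\in L^p(\Omega)$ let $\operatorname{essVar}_\Omega u$ be the infimum of the pointwise variations on $\Omega$ of all representatives of $u$, and write $u\in BPV(\Omega;\pm1)$ if $u$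 has a representative $\Omega\to\{-1,1\}$ of finite pointwise variation. Let $F(u)=\alpha\operatorname{essVar}_\Omega u$ if $u\in BPV(\Omega;\pm1)$ and $F(u)=+\infty$ for all other $u\in L^p(\Omega)$. Then $F_{\epsilon_n}$ $\Gamma$-converges to $F$ with respect to strong convergence in $L^p(\Omega)$; that is, for every $u\in L^p(\Omega)$: (i) $\liminf_{n\to\infty}F_{\epsilon_n}(u_n)\ge F(u)$ for every sequence $u_n\to u$ in $L^p(\Omega)$; and (ii) there is a sequence $u_n\to u$ in $L^p(\Omega)$ with $\limsup_{n\to\infty}F_{\epsilon_n}(u_n)\le F(u)$. -/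

import Mathlib

open MeasureTheory Set Filter Topology
open scoped ENNReal ContDiff

noncomputable section

namespace PhaseTransition

/-- `v ∈ L^p(Ω)` is a weak derivative of order `k` of `u` on the open set `Ω ⊆ ℝ`:
`∫_Ω u φ^(k) = (-1)^k ∫_Ω v φ` for all `φ ∈ C_c^∞(Ω)`. -/
def IsWeakDeriv (p : ℝ≥0∞) (Ω : Set ℝ) (k : ℕ) (u v : ℝ → ℝ) : Prop :=
  MemLp v p (volume.restrict Ω) ∧
    ∀ φ : ℝ → ℝ, ContDiff ℝ ∞ φ → HasCompactSupport φ → tsupport φ ⊆ Ω →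
      ∫ x in Ω, u x * iteratedDeriv k φ x = (-1) ^ k * ∫ x in Ω, v x * φ x

/-- `u ∈ W^{k,p}(Ω)`: `u ∈ L^p(Ω)` has weak derivatives of all orders `1 ≤ l ≤ k` in `L^p(Ω)`. -/
def MemSobolev (k : ℕ) (p : ℝ≥0∞) (Ω : Set ℝ) (u : ℝ → ℝ) : Prop :=
  MemLp u p (volume.restrict Ω) ∧ ∀ l : ℕ, 1 ≤ l → l ≤ k → ∃ v, IsWeakDeriv p Ω l u v

open Classical in
/-- The weak derivative of order `k` of `u` on `Ω` (unique up to a.e. equality on `Ω`);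
it is only used where it exists. -/
def weakDeriv (p : ℝ≥0∞) (Ω : Set ℝ) (k : ℕ) (u : ℝ → ℝ) : ℝ → ℝ :=
  if h : ∃ v, IsWeakDeriv p Ω k u v then h.choose else 0

/-- The space `L^p(Ω)` of classes of real functions, with its norm. -/
abbrev LpOn (p : ℝ≥0∞) (Ω : Set ℝ) : Type := Lp ℝ p ((volume : Measure ℝ).restrict Ω)

open Classical in
/-- The functional `F_ε : L^p(Ω) → [-∞, ∞]`, equal to
`∫_Ω ε⁻¹ (u² - 1)² + ε³ |u''|²` (an integral of a nonnegative function, possibly `+∞`)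
on `W^{2,p}(Ω)` and to `+∞` elsewhere. -/
def energy (p : ℝ≥0∞) (Ω : Set ℝ) (ε : ℝ) (u : LpOn p Ω) : EReal :=
  if MemSobolev 2 p Ω u then
    ((∫⁻ x in Ω, ENNReal.ofReal
      (ε⁻¹ * (u x ^ 2 - 1) ^ 2 + ε ^ 3 * |weakDeriv p Ω 2 u x| ^ 2) : ℝ≥0∞) : EReal)
  else ⊤

/-- `Φ(u) = (∫₀¹ (u² - 1)²)^{3/4} (∫₀¹ |u''|²)^{1/4}`. -/
def Phi (p : ℝ≥0∞) (u : ℝ → ℝ) : ℝ≥0∞ :=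
  (∫⁻ y in Ioo (0 : ℝ) 1, ENNReal.ofReal ((u y ^ 2 - 1) ^ 2)) ^ (3 / 4 : ℝ) *
    (∫⁻ y in Ioo (0 : ℝ) 1, ENNReal.ofReal (|weakDeriv p (Ioo 0 1) 2 u y| ^ 2)) ^ (1 / 4 : ℝ)

/-- The family of all `u ∈ W^{2,p}(0,1)` with `u(0₊) = -1`, `u(1₋) = 1`, `u'(0₊) = u'(1₋) = 0`.
Each class in `W^{2,p}(0,1)` has exactly one representative on `(0,1)` that is continuously
differentiable, and it is this representative that is listed here. -/
def family (p : ℝ≥0∞) : Set (ℝ → ℝ) :=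
  {u | MemSobolev 2 p (Ioo 0 1) u ∧ ContDiffOn ℝ 1 u (Ioo 0 1) ∧
    Tendsto u (𝓝[>] 0) (𝓝 (-1)) ∧ Tendsto u (𝓝[<] 1) (𝓝 1) ∧
    Tendsto (deriv u) (𝓝[>] 0) (𝓝 0) ∧ Tendsto (deriv u) (𝓝[<] 1) (𝓝 0)}

/-- `α = (2 / 3^{3/4}) inf Φ`, the infimum over the family above. -/
def alpha (p : ℝ≥0∞) : ℝ≥0∞ :=
  ENNReal.ofReal (2 / 3 ^ (3 / 4 : ℝ)) * ⨅ u ∈ family p, Phi p u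

/-- The essential variation of `u` on `I`: the infimum of the pointwise variations on `I` of the
representatives of `u`. -/
def essVar (I : Set ℝ) (u : ℝ → ℝ) : ℝ≥0∞ :=
  ⨅ (w : ℝ → ℝ) (_ : w =ᵐ[volume.restrict I] u), eVariationOn w I

/-- `u ∈ BPV(I; {-1, 1})`: some representative of `u` takes only the values `-1` and `1` on `I`
and has finite pointwise variation there. -/
def MemBPV (I : Set ℝ) (u : ℝ → ℝ) : Prop :=
  ∃ w : ℝ → ℝ, w =ᵐ[volume.restrict I] u ∧ BoundedVariationOn w I ∧ ∀ x ∈ I, w x = -1 ∨ w x = 1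

open Classical in
/-- The limit functional: `α essVar_Ω u` on `BPV(Ω; {-1, 1})` and `+∞` elsewhere. -/
def limitEnergy (p : ℝ≥0∞) (Ω : Set ℝ) (u : LpOn p Ω) : EReal :=
  if MemBPV Ω u then ((alpha p * essVar Ω u : ℝ≥0∞) : EReal) else ⊤

/-- Gamma convergence of a sequence of extended real valued functions on a metric space. -/
def GammaConverges {X : Type*} [MetricSpace X] (f : ℕ → X → EReal) (g : X → EReal) : Prop :=
  ∀ x₀ : X,
    (∀ x : ℕ → X, Tendsto x atTop (𝓝 x₀) → g x₀ ≤ liminf (fun n => f n (x n)) atTop) ∧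
    ∃ x : ℕ → X, Tendsto x atTop (𝓝 x₀) ∧ limsup (fun n => f n (x n)) atTop ≤ g x₀

end PhaseTransition

end

/-!
A function in `W^{2,p}(a, b)` has a `C¹` representative `U` whose slope `V` is the primitive of the
weak second derivative `g`; `TwicePrimitive p U V g` records this, with all functions extended to
`ℝ`. That every `W^{2,p}` function arises in this way is the lemma of du Bois-Reymond
(`MemSobolev.exists_twicePrimitive`), and the converse is integration by parts. For such triples,
substituting `x ↦ k x + m` multiplies the parameter `ε` of the energy by `k`
(`localEnergy_comp_affine`), so that everything happens at scale `1`.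

The constant. If `A` and `B` are the two integrals in `Phi`, then by Young's inequality
`A^{3/4} B^{1/4} · 4 / 3^{3/4} ≤ ε⁻¹ A + ε³ B`, and a suitable `ε` makes this sharp
(`two_mul_rpow_le`, `exists_scale_lt`). Since `Phi` is scale invariant, a transition from `-1` to `1`
on an interval of any length, with zero slopes at its ends, costs at least `2 α`, and the cost can be
brought as close to `2 α` as desired by the choice of the profile and its scale.

The lower bound. If the energy at scale `1` on a unit interval is at most `τ²`, then the function is
within `O(τ)` of a well `±1` there, and its slope is `O(τ)` (`TwicePrimitive.near_well`). One
consequence is that `α > 0`. Another is compactness: by Tonelli's theorem the energies on the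
intervals `(x, x + ε_n)` have integral at most `ε_n` times the total energy, hence along a
subsequence they tend to zero for almost every `x`, and there `|u_n(x)| → 1` and
`ε_n u_n'(x) → 0` (`ae_tendsto_of_localEnergy_le`). Between two such points at which the limit has
opposite signs, gluing on cubic Hermite interpolants of energy `o(1)` turns `u_n` into a full
transition, which costs `2 α`. Summing up, `α` times the variation of the limit along almost all
points is at most the limit of the energies, and a `±1`-valued representative on the whole interval
with no greater variation is obtained from one-sided limit values
(`exists_representative_eVariationOn_le`).

The upper bound. A representative `w` of `u` of nearly minimal variation is almost everywhere
continuous, so that `u` is the limit in `L^p` of step functions whose values are taken from `w` at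
points where `w = ±1` (`exists_tendsto_stepFun`). Replacing each jump by a scaled, nearly optimal
profile costs at most slightly more than `α` times the variation of the step function, hence of `w`
(`IsProfile.localEnergy_superpose_le`); a diagonal argument finishes the proof.
-/

noncomputable section

namespace PhaseTransition

/-! ### Functions with an `L^p` second derivative -/

/-- `U : ℝ → ℝ` is continuously differentiable with derivative `V`, and `V` is a primitive of `g`,
which is in `L^p` on bounded intervals. Such triples are the precise representatives of functions
that are locally in `W^{2,p}`, together with their first and second derivatives. -/
structure TwicePrimitive (p : ℝ≥0∞) (U V g : ℝ → ℝ) : Prop where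
  measurable : Measurable g
  memLp : ∀ x y, MemLp g p (volume.restrict (Ioo x y))
  hasDerivAt : ∀ x, HasDerivAt U (V x) x
  sub_eq : ∀ x y, V y - V x = ∫ t in x..y, g t

theorem memLp_restrict_Ioo_of_continuous {p : ℝ≥0∞} {f : ℝ → ℝ} {a b : ℝ}
    (hf : Continuous f) : MemLp f p (volume.restrict (Ioo a b)) := by
  obtain ⟨C, hC⟩ := (isCompact_Icc (a := a) (b := b)).exists_bound_of_continuousOn hf.continuousOn
  refine MemLp.of_bound hf.aestronglyMeasurable C ?_
  filter_upwards [ae_restrict_mem measurableSet_Ioo] with x hx using hC x (Ioo_subset_Icc_self hx)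

namespace TwicePrimitive

variable {p : ℝ≥0∞} {U V g : ℝ → ℝ}

theorem intervalIntegrable (hp : 1 ≤ p) (h : TwicePrimitive p U V g) (x y : ℝ) :
    IntervalIntegrable g volume x y := by
  rw [intervalIntegrable_iff, uIoc, ← integrableOn_Icc_iff_integrableOn_Ioc,
    integrableOn_Icc_iff_integrableOn_Ioo]
  exact (h.memLp _ _).integrable hp

theorem continuous_deriv (hp : 1 ≤ p) (h : TwicePrimitive p U V g) : Continuous V := by
  have h1 : V = fun y => V 0 + ∫ t in (0 : ℝ)..y, g t := by
    funext y; linarith [h.sub_eq 0 y]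
  rw [h1]
  exact continuous_const.add (intervalIntegral.continuous_primitive
    (fun a b => h.intervalIntegrable hp a b) 0)

theorem continuous (h : TwicePrimitive p U V g) : Continuous U :=
  continuous_iff_continuousAt.2 fun x => (h.hasDerivAt x).continuousAt

theorem deriv_eq (h : TwicePrimitive p U V g) : deriv U = V :=
  funext fun x => (h.hasDerivAt x).deriv

theorem contDiff (hp : 1 ≤ p) (h : TwicePrimitive p U V g) : ContDiff ℝ 1 U := by
  rw [contDiff_one_iff_deriv]
  exact ⟨fun x => (h.hasDerivAt x).differentiableAt, h.deriv_eq ▸ h.continuous_deriv hp⟩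

end TwicePrimitive

/-- A smooth function whose topological support is a compact subset of `(a, b)` vanishes at `a`
and `b`. -/
theorem eq_zero_of_tsupport_subset {φ : ℝ → ℝ} {a b x : ℝ} (h : tsupport φ ⊆ Ioo a b)
    (hx : x ∉ Ioo a b) : φ x = 0 := by
  by_contra h0
  exact hx (h (subset_tsupport _ h0))

theorem setIntegral_Ioo_eq {f : ℝ → ℝ} {a b : ℝ} (hab : a < b) :
    ∫ x in Ioo a b, f x = ∫ x in a..b, f x := by
  rw [intervalIntegral.integral_of_le hab.le, integral_Ioc_eq_integral_Ioo]

/-- Integration by parts against a test function, for a primitive of a locally integrable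
function. -/
theorem integral_primitive_mul_deriv {V g φ : ℝ → ℝ} {a b : ℝ} (hab : a < b)
    (hg : IntervalIntegrable g volume a b) (hV : ∀ x ∈ Icc a b, V x - V a = ∫ t in a..x, g t)
    (hφ : ContDiff ℝ ∞ φ) (hs : tsupport φ ⊆ Ioo a b) :
    ∫ x in Ioo a b, V x * deriv φ x = -∫ x in Ioo a b, g x * φ x := by
  have hac := hg.absolutelyContinuousOnInterval_intervalIntegral (c := a) (by simp)
  have hφac : AbsolutelyContinuousOnInterval φ a b :=
    (hφ.of_le (by simp)).contDiffOn.absolutelyContinuousOnInterval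
  have h1 := hac.integral_mul_deriv_eq_deriv_mul hφac
  have ha : φ a = 0 := eq_zero_of_tsupport_subset hs (by simp)
  have hb : φ b = 0 := eq_zero_of_tsupport_subset hs (by simp)
  have hdφ : Continuous (deriv φ) := hφ.continuous_deriv (by simp)
  have h2 : ∫ x in a..b, deriv (fun x => ∫ t in a..x, g t) x * φ x = ∫ x in a..b, g x * φ x := by
    apply intervalIntegral.integral_congr_ae
    filter_upwards [hg.ae_hasDerivAt_integral] with x hx hx'
    rw [(hx (uIoc_subset_uIcc hx') a (by simp)).deriv]
  have h3 : ∫ x in a..b, V x * deriv φ x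
      = ∫ x in a..b, (V a * deriv φ x + (∫ t in a..x, g t) * deriv φ x) := by
    apply intervalIntegral.integral_congr
    intro x hx
    rw [uIcc_of_le hab.le] at hx
    have := hV x hx
    simp only
    rw [← this]; ring
  rw [setIntegral_Ioo_eq hab, setIntegral_Ioo_eq hab, h3, intervalIntegral.integral_add,
    intervalIntegral.integral_const_mul, h1, h2, ha, hb,
    intervalIntegral.integral_deriv_eq_sub (fun x _ => (hφ.differentiable (by simp)) x)
      (hdφ.intervalIntegrable _ _), ha, hb]
  · ring
  · exact (continuous_const.mul hdφ).intervalIntegrable _ _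
  · exact (hdφ.intervalIntegrable _ _).continuousOn_mul hac.continuousOn

theorem tsupport_deriv_subset_of {φ : ℝ → ℝ} {S : Set ℝ} (h : tsupport φ ⊆ S) :
    tsupport (deriv φ) ⊆ S :=
  (closure_minimal (support_deriv_subset) (isClosed_tsupport φ)).trans h

theorem contDiff_deriv {φ : ℝ → ℝ} (h : ContDiff ℝ ∞ φ) : ContDiff ℝ ∞ (deriv φ) :=
  (contDiff_infty_iff_deriv.1 h).2

namespace TwicePrimitive

variable {p : ℝ≥0∞} {U V g : ℝ → ℝ}

theorem isWeakDeriv_one (hp : 1 ≤ p) (h : TwicePrimitive p U V g) {a b : ℝ} (hab : a < b) :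
    IsWeakDeriv p (Ioo a b) 1 U V := by
  refine ⟨memLp_restrict_Ioo_of_continuous (h.continuous_deriv hp), fun φ hφ _ hs => ?_⟩
  rw [iteratedDeriv_one, integral_primitive_mul_deriv hab
    ((h.continuous_deriv hp).intervalIntegrable _ _) (fun x _ => ?_) hφ hs]
  · ring
  · exact (intervalIntegral.integral_eq_sub_of_hasDerivAt (fun x _ => h.hasDerivAt x)
      ((h.continuous_deriv hp).intervalIntegrable _ _)).symm

theorem isWeakDeriv_two (hp : 1 ≤ p) (h : TwicePrimitive p U V g) {a b : ℝ} (hab : a < b) :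
    IsWeakDeriv p (Ioo a b) 2 U g := by
  refine ⟨h.memLp _ _, fun φ hφ hc hs => ?_⟩
  have h1 := (h.isWeakDeriv_one hp hab).2 (deriv φ) (contDiff_deriv hφ) hc.deriv
    (tsupport_deriv_subset_of hs)
  have h2 : iteratedDeriv 2 φ = iteratedDeriv 1 (deriv φ) := by
    rw [iteratedDeriv_succ', iteratedDeriv_one]
  rw [h2, h1, integral_primitive_mul_deriv hab (h.intervalIntegrable hp a b)
    (fun x _ => h.sub_eq a x) hφ hs]
  ring

end TwicePrimitive

/-- Two functions with the same integrals against all test functions on `Ω` agree a.e. on `Ω`. -/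
theorem ae_eq_of_integral_mul_eq {p : ℝ≥0∞} (hp : 1 ≤ p) {Ω : Set ℝ} (hΩ : IsOpen Ω)
    {v v' : ℝ → ℝ} (hv : MemLp v p (volume.restrict Ω)) (hv' : MemLp v' p (volume.restrict Ω))
    (h : ∀ φ : ℝ → ℝ, ContDiff ℝ ∞ φ → HasCompactSupport φ → tsupport φ ⊆ Ω →
      ∫ x in Ω, v x * φ x = ∫ x in Ω, v' x * φ x) :
    v =ᵐ[volume.restrict Ω] v' := by
  have hl : ∀ {f : ℝ → ℝ}, MemLp f p (volume.restrict Ω) → LocallyIntegrable f (volume.restrict Ω) :=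
    fun hf => hf.locallyIntegrable hp
  have hloc : LocallyIntegrableOn (v - v') Ω volume := by
    intro x hx
    obtain ⟨s, hs, hsi⟩ := (hl (hv.sub hv')) x
    refine ⟨s ∩ Ω, inter_mem (mem_nhdsWithin_of_mem_nhds hs) self_mem_nhdsWithin, ?_⟩
    rw [IntegrableOn, Measure.restrict_restrict' hΩ.measurableSet] at hsi
    exact hsi
  have key := hΩ.ae_eq_zero_of_integral_contDiff_smul_eq_zero hloc (fun φ hφ hc hs => ?_)
  · rw [EventuallyEq, ae_restrict_iff' hΩ.measurableSet]
    filter_upwards [key] with x hx hxΩ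
    exact sub_eq_zero.1 (hx hxΩ)
  · have hint : ∀ {f : ℝ → ℝ}, MemLp f p (volume.restrict Ω) →
        Integrable (fun x => f x * φ x) (volume.restrict Ω) := fun hf => by
      have := (hl hf).integrable_smul_left_of_hasCompactSupport hφ.continuous hc
      simpa [mul_comm] using this
    rw [← setIntegral_eq_integral_of_forall_compl_eq_zero (s := Ω)
      (fun x hx => by rw [image_eq_zero_of_notMem_tsupport (fun h => hx (hs h))]; simp)]
    have := h φ hφ hc hs
    simp only [smul_eq_mul, Pi.sub_apply, mul_sub]
    simp only [mul_comm (φ _)]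
    rw [integral_sub (hint hv) (hint hv'), this, sub_self]

theorem IsWeakDeriv.ae_eq {p : ℝ≥0∞} (hp : 1 ≤ p) {Ω : Set ℝ} (hΩ : IsOpen Ω) {k : ℕ}
    {u v v' : ℝ → ℝ} (hv : IsWeakDeriv p Ω k u v) (hv' : IsWeakDeriv p Ω k u v') :
    v =ᵐ[volume.restrict Ω] v' := by
  refine ae_eq_of_integral_mul_eq hp hΩ hv.1 hv'.1 fun φ hφ hc hs => ?_
  have h := (hv.2 φ hφ hc hs).symm.trans (hv'.2 φ hφ hc hs)
  exact mul_left_cancel₀ (pow_ne_zero _ (by norm_num)) h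

theorem IsWeakDeriv.congr {p : ℝ≥0∞} {Ω : Set ℝ} {k : ℕ} {u u' v : ℝ → ℝ}
    (h : IsWeakDeriv p Ω k u v) (hu : u =ᵐ[volume.restrict Ω] u') : IsWeakDeriv p Ω k u' v := by
  refine ⟨h.1, fun φ hφ hc hs => ?_⟩
  rw [← h.2 φ hφ hc hs]
  exact integral_congr_ae (by filter_upwards [hu] with x hx; rw [hx])

theorem isWeakDeriv_weakDeriv {p : ℝ≥0∞} {Ω : Set ℝ} {k : ℕ} {u : ℝ → ℝ}
    (h : ∃ v, IsWeakDeriv p Ω k u v) : IsWeakDeriv p Ω k u (weakDeriv p Ω k u) := by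
  rw [weakDeriv, dif_pos h]
  exact h.choose_spec

namespace TwicePrimitive

variable {p : ℝ≥0∞} {U V g : ℝ → ℝ}

theorem memSobolev (hp : 1 ≤ p) (h : TwicePrimitive p U V g) {a b : ℝ} (hab : a < b)
    {u : ℝ → ℝ} (hu : U =ᵐ[volume.restrict (Ioo a b)] u) : MemSobolev 2 p (Ioo a b) u := by
  refine ⟨(memLp_congr_ae hu).1 (memLp_restrict_Ioo_of_continuous h.continuous), fun l hl hl' => ?_⟩
  obtain rfl | rfl : l = 1 ∨ l = 2 := by omega
  · exact ⟨V, (h.isWeakDeriv_one hp hab).congr hu⟩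
  · exact ⟨g, (h.isWeakDeriv_two hp hab).congr hu⟩

theorem weakDeriv_ae_eq (hp : 1 ≤ p) (h : TwicePrimitive p U V g) {a b : ℝ} (hab : a < b)
    {u : ℝ → ℝ} (hu : U =ᵐ[volume.restrict (Ioo a b)] u) :
    weakDeriv p (Ioo a b) 2 u =ᵐ[volume.restrict (Ioo a b)] g := by
  have h2 := (h.isWeakDeriv_two hp hab).congr hu
  exact (isWeakDeriv_weakDeriv ⟨g, h2⟩).ae_eq hp isOpen_Ioo h2

end TwicePrimitive

/-- A test function on `(a, b)` with integral zero is the derivative of a test function. -/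
theorem exists_test_primitive {ψ : ℝ → ℝ} {a b : ℝ} (hψ : ContDiff ℝ ∞ ψ)
    (hc : HasCompactSupport ψ) (hs : tsupport ψ ⊆ Ioo a b) (h0 : ∫ x in a..b, ψ x = 0) :
    ∃ φ : ℝ → ℝ, ContDiff ℝ ∞ φ ∧ HasCompactSupport φ ∧ tsupport φ ⊆ Ioo a b ∧ deriv φ = ψ := by
  by_cases hne : (tsupport ψ).Nonempty
  swap
  · have hz : ψ = 0 := by
      rw [not_nonempty_iff_eq_empty, tsupport_eq_empty_iff] at hne
      exact hne
    refine ⟨0, contDiff_const, HasCompactSupport.zero, ?_, ?_⟩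
    · simp [tsupport]
    · rw [hz]; exact funext fun x => by simp
  obtain ⟨c, hcm, hcl⟩ := hc.isCompact.exists_isLeast hne
  obtain ⟨d, hdm, hdg⟩ := hc.isCompact.exists_isGreatest hne
  have hout : ∀ x, x ∉ Icc c d → ψ x = 0 := fun x hx => by
    by_contra h
    have := subset_tsupport ψ h
    exact hx ⟨hcl this, hdg this⟩
  have hcont := hψ.continuous
  have hd : ∀ x, HasDerivAt (fun x => ∫ t in a..x, ψ t) (ψ x) x := fun x =>
    intervalIntegral.integral_hasDerivAt_right (hcont.intervalIntegrable _ _)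
      hcont.aestronglyMeasurable.stronglyMeasurableAtFilter hcont.continuousAt
  have hderiv : deriv (fun x => ∫ t in a..x, ψ t) = ψ := funext fun x => (hd x).deriv
  have hac := (hs hcm).1
  have hdb := (hs hdm).2
  have hcd : c ≤ d := hcl hdm
  have hsup : Function.support (fun x => ∫ t in a..x, ψ t) ⊆ Icc c d := by
    intro x hx
    by_contra hxn
    apply hx
    have hcases : x < c ∨ d < x := by
      by_contra hh
      push Not at hh
      exact hxn ⟨hh.1, hh.2⟩
    rcases hcases with hxc | hxd
    · have : ∫ t in a..x, ψ t = ∫ t in a..x, (0 : ℝ) := by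
        apply intervalIntegral.integral_congr
        intro t ht
        apply hout
        intro h
        have : t ≤ max a x := ht.2
        have : max a x < c := max_lt hac hxc
        linarith [h.1]
      simp only [this, intervalIntegral.integral_zero]
    · have h1 : ∫ t in x..b, ψ t = ∫ t in x..b, (0 : ℝ) := by
        apply intervalIntegral.integral_congr
        intro t ht
        apply hout
        intro h
        have : min x b ≤ t := ht.1
        have : d < min x b := lt_min hxd hdb
        linarith [h.2]
      have h2 := intervalIntegral.integral_add_adjacent_intervals
        (hcont.intervalIntegrable (μ := volume) a x) (hcont.intervalIntegrable x b)
      rw [h1, h0] at h2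
      simpa using h2
  have hts : tsupport (fun x => ∫ t in a..x, ψ t) ⊆ Icc c d := closure_minimal hsup isClosed_Icc
  refine ⟨fun x => ∫ t in a..x, ψ t, ?_, ?_, ?_, hderiv⟩
  · rw [contDiff_infty_iff_deriv, hderiv]
    exact ⟨fun x => (hd x).differentiableAt, hψ⟩
  · exact HasCompactSupport.of_support_subset_isCompact isCompact_Icc hsup
  · exact hts.trans fun x hx => ⟨hac.trans_le hx.1, hx.2.trans_lt hdb⟩

/-- The lemma of du Bois-Reymond: a function with weak derivative zero is constant. -/
theorem ae_eq_const_of_integral_mul_deriv_eq_zero {p : ℝ≥0∞} (hp : 1 ≤ p) {f : ℝ → ℝ} {a b : ℝ}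
    (hab : a < b) (hf : MemLp f p (volume.restrict (Ioo a b)))
    (h : ∀ φ : ℝ → ℝ, ContDiff ℝ ∞ φ → HasCompactSupport φ → tsupport φ ⊆ Ioo a b →
      ∫ x in Ioo a b, f x * deriv φ x = 0) :
    ∃ c : ℝ, f =ᵐ[volume.restrict (Ioo a b)] fun _ => c := by
  -- a fixed test function with positive integral
  let B : ContDiffBump ((a + b) / 2) := ⟨(b - a) / 8, (b - a) / 4, by linarith, by linarith⟩
  have hBs : tsupport B ⊆ Ioo a b := by
    rw [B.tsupport_eq, Real.closedBall_eq_Icc]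
    intro x hx
    have h1 : B.rOut = (b - a) / 4 := rfl
    rw [h1] at hx
    constructor <;> linarith [hx.1, hx.2]
  have hBc : HasCompactSupport B := B.hasCompactSupport
  have hBd : ContDiff ℝ ∞ B := B.contDiff
  have hBi : ∫ x in a..b, B x ≠ 0 := by
    have h1 : ∫ x in a..b, B x = ∫ x, B x := by
      rw [← setIntegral_Ioo_eq hab]
      exact setIntegral_eq_integral_of_forall_compl_eq_zero
        (fun x hx => eq_zero_of_tsupport_subset hBs hx)
    rw [h1]
    exact (B.integral_pos (μ := volume)).ne'
  set I := ∫ x in a..b, B x with hI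
  refine ⟨(∫ x in Ioo a b, f x * B x) / I, ae_eq_of_integral_mul_eq hp isOpen_Ioo hf
    (memLp_const _) fun ψ hψ hc hs => ?_⟩
  have hψc := hψ.continuous
  have hBcont := hBd.continuous
  have hs' : tsupport (fun x => ψ x - (∫ x in a..b, ψ x) / I * B x) ⊆ Ioo a b :=
    (tsupport_sub _ _).trans (union_subset hs
      ((closure_mono (Function.support_mul_subset_right _ _)).trans hBs))
  have h0 : ∫ x in a..b, (ψ x - (∫ x in a..b, ψ x) / I * B x) = 0 := by
    rw [intervalIntegral.integral_sub (hψc.intervalIntegrable _ _)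
      ((hBcont.intervalIntegrable _ _).const_mul _), intervalIntegral.integral_const_mul,
      ← hI, div_mul_cancel₀ _ hBi, sub_self]
  obtain ⟨φ, hφ, hφc, hφs, hφd⟩ := exists_test_primitive
    (hψ.sub (contDiff_const.mul hBd)) (hc.sub (hBc.mul_left)) hs' h0
  have h1 := h φ hφ hφc hφs
  rw [hφd] at h1
  have hint : ∀ {χ : ℝ → ℝ}, Continuous χ → HasCompactSupport χ →
      Integrable (fun x => f x * χ x) (volume.restrict (Ioo a b)) := fun hχ hχc => by
    have := (hf.locallyIntegrable hp).integrable_smul_left_of_hasCompactSupport hχ hχc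
    simpa [mul_comm] using this
  have h2 : ∫ x in Ioo a b, f x * (ψ x - (∫ x in a..b, ψ x) / I * B x)
      = ∫ x in Ioo a b, (f x * ψ x - (∫ x in a..b, ψ x) / I * (f x * B x)) := by
    congr 1; funext x; ring
  rw [h2, integral_sub (hint hψc hc) ((hint hBcont hBc).const_mul _), integral_const_mul] at h1
  rw [integral_const_mul, setIntegral_Ioo_eq hab (f := ψ), sub_eq_zero.1 h1]
  ring

/-- A function with integrable weak derivative `g` is, up to a constant, the primitive of `g`. -/
theorem ae_eq_primitive {p : ℝ≥0∞} (hp : 1 ≤ p) {f g : ℝ → ℝ} {a b : ℝ}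
    (hab : a < b) (hf : MemLp f p (volume.restrict (Ioo a b)))
    (hg : ∀ x y, IntervalIntegrable g volume x y)
    (h : ∀ φ : ℝ → ℝ, ContDiff ℝ ∞ φ → HasCompactSupport φ → tsupport φ ⊆ Ioo a b →
      ∫ x in Ioo a b, f x * deriv φ x = -∫ x in Ioo a b, g x * φ x) :
    ∃ c : ℝ, f =ᵐ[volume.restrict (Ioo a b)] fun x => c + ∫ t in a..x, g t := by
  have hG : Continuous fun x => ∫ t in a..x, g t := intervalIntegral.continuous_primitive hg a
  have hGm : MemLp (fun x => ∫ t in a..x, g t) p (volume.restrict (Ioo a b)) :=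
    memLp_restrict_Ioo_of_continuous hG
  obtain ⟨c, hc⟩ := ae_eq_const_of_integral_mul_deriv_eq_zero hp hab (hf.sub hGm)
    fun φ hφ hc hs => by
      have hint : ∀ {k : ℝ → ℝ}, MemLp k p (volume.restrict (Ioo a b)) →
          Integrable (fun x => k x * deriv φ x) (volume.restrict (Ioo a b)) := fun hk => by
        have := (hk.locallyIntegrable hp).integrable_smul_left_of_hasCompactSupport
          (contDiff_deriv hφ).continuous hc.deriv
        simpa [mul_comm] using this
      simp only [Pi.sub_apply, sub_mul]
      rw [integral_sub (hint hf) (hint hGm), h φ hφ hc hs, integral_primitive_mul_deriv hab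
        (hg a b) (fun x _ => by simp) hφ hs, sub_self]
  refine ⟨c, ?_⟩
  filter_upwards [hc] with x hx
  simp only [Pi.sub_apply] at hx
  linarith

/-- Every `u ∈ W^{2,p}(a,b)` has a `C¹` representative that extends to `ℝ`, with a second derivative
that vanishes outside `(a, b)`. -/
theorem MemSobolev.exists_twicePrimitive {p : ℝ≥0∞} (hp : 1 ≤ p) {u : ℝ → ℝ} {a b : ℝ}
    (hab : a < b) (h : MemSobolev 2 p (Ioo a b) u) :
    ∃ U V g, TwicePrimitive p U V g ∧ (∀ x, x ∉ Ioo a b → g x = 0) ∧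
      u =ᵐ[volume.restrict (Ioo a b)] U ∧
      weakDeriv p (Ioo a b) 2 u =ᵐ[volume.restrict (Ioo a b)] g := by
  obtain ⟨v, hv⟩ := h.2 1 le_rfl (by norm_num)
  have hw := isWeakDeriv_weakDeriv (h.2 2 (by norm_num) le_rfl)
  set w := weakDeriv p (Ioo a b) 2 u
  let g : ℝ → ℝ := (Ioo a b).indicator (hw.1.1.mk w)
  have hgm : Measurable g := hw.1.1.stronglyMeasurable_mk.measurable.indicator measurableSet_Ioo
  have hwg : w =ᵐ[volume.restrict (Ioo a b)] g := by
    filter_upwards [hw.1.1.ae_eq_mk, ae_restrict_mem measurableSet_Ioo] with x hx hxm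
    simp only [g, indicator_of_mem hxm, hx]
  have hg0 : ∀ x, x ∉ Ioo a b → g x = 0 := fun x hx => indicator_of_notMem hx _
  have hgLp : MemLp g p volume :=
    (memLp_indicator_iff_restrict measurableSet_Ioo).2 ((memLp_congr_ae hw.1.1.ae_eq_mk).1 hw.1)
  have hgl : ∀ x y, IntervalIntegrable g volume x y := fun x y => by
    rw [intervalIntegrable_iff, uIoc, ← integrableOn_Icc_iff_integrableOn_Ioc,
      integrableOn_Icc_iff_integrableOn_Ioo]
    exact (hgLp.restrict _).integrable hp
  -- `v` is a primitive of `g`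
  obtain ⟨c, hc⟩ := ae_eq_primitive hp hab hv.1 hgl fun φ hφ hφc hs => by
    have h1 := hv.2 (deriv φ) (contDiff_deriv hφ) hφc.deriv (tsupport_deriv_subset_of hs)
    have h2 := hw.2 φ hφ hφc hs
    rw [iteratedDeriv_succ'] at h2
    rw [h2] at h1
    have h3 : ∫ x in Ioo a b, w x * φ x = ∫ x in Ioo a b, g x * φ x :=
      integral_congr_ae (by filter_upwards [hwg] with x hx; rw [hx])
    rw [← h3]
    linarith
  set V : ℝ → ℝ := fun x => c + ∫ t in a..x, g t with hV
  have hVc : Continuous V := continuous_const.add (intervalIntegral.continuous_primitive hgl a)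
  -- `u` is a primitive of `V`
  obtain ⟨c', hc'⟩ := ae_eq_primitive hp hab h.1 (fun x y => hVc.intervalIntegrable x y)
    fun φ hφ hφc hs => by
      have h1 := hv.2 φ hφ hφc hs
      rw [iteratedDeriv_one] at h1
      rw [h1, integral_congr_ae (g := fun x => V x * φ x)
        (by filter_upwards [hc] with x hx; rw [hx])]
      ring
  refine ⟨fun x => c' + ∫ t in a..x, V t, V, g, ⟨hgm, fun x y => hgLp.restrict _, fun x => ?_,
    fun x y => ?_⟩, hg0, hc', hwg⟩
  · exact (intervalIntegral.integral_hasDerivAt_right (hVc.intervalIntegrable _ _)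
      hVc.aestronglyMeasurable.stronglyMeasurableAtFilter hVc.continuousAt).const_add c'
  · simp only [hV]
    rw [← intervalIntegral.integral_add_adjacent_intervals (hgl a x) (hgl x y)]
    ring

/-! ### Superposition, gluing and scaling -/

namespace TwicePrimitive

variable {p : ℝ≥0∞} {U V g U' V' g' : ℝ → ℝ}

theorem of_continuous (hU : ∀ x, HasDerivAt U (V x) x) (hV : ∀ x, HasDerivAt V (g x) x)
    (hg : Continuous g) : TwicePrimitive p U V g :=
  ⟨hg.measurable, fun _ _ => memLp_restrict_Ioo_of_continuous hg, hU, fun _ _ =>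
    (intervalIntegral.integral_eq_sub_of_hasDerivAt (fun t _ => hV t)
      (hg.intervalIntegrable _ _)).symm⟩

theorem const (c : ℝ) : TwicePrimitive p (fun _ => c) (fun _ => 0) (fun _ => 0) :=
  of_continuous (fun x => hasDerivAt_const x c) (fun x => hasDerivAt_const x 0) continuous_const

theorem add (hp : 1 ≤ p) (h : TwicePrimitive p U V g) (h' : TwicePrimitive p U' V' g') :
    TwicePrimitive p (fun x => U x + U' x) (fun x => V x + V' x) (fun x => g x + g' x) :=
  ⟨h.measurable.add h'.measurable, fun x y => (h.memLp x y).add (h'.memLp x y),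
    fun x => (h.hasDerivAt x).add (h'.hasDerivAt x), fun x y => by
      rw [intervalIntegral.integral_add (h.intervalIntegrable hp x y)
        (h'.intervalIntegrable hp x y), ← h.sub_eq, ← h'.sub_eq]
      ring⟩

theorem const_mul (c : ℝ) (h : TwicePrimitive p U V g) :
    TwicePrimitive p (fun x => c * U x) (fun x => c * V x) (fun x => c * g x) :=
  ⟨h.measurable.const_mul c, fun x y => (h.memLp x y).const_mul c,
    fun x => (h.hasDerivAt x).const_mul c, fun x y => by
      rw [intervalIntegral.integral_const_mul, ← h.sub_eq]
      ring⟩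

theorem neg (h : TwicePrimitive p U V g) :
    TwicePrimitive p (fun x => -U x) (fun x => -V x) (fun x => -g x) := by
  simpa using h.const_mul (-1)

/-- Two triples that agree to first order at `c` can be glued there. -/
theorem glue (hp : 1 ≤ p) (h : TwicePrimitive p U V g) (h' : TwicePrimitive p U' V' g') {c : ℝ}
    (hU : U c = U' c) (hV : V c = V' c) :
    TwicePrimitive p (fun x => if x ≤ c then U x else U' x) (fun x => if x ≤ c then V x else V' x)
      (fun x => if x ≤ c then g x else g' x) := by
  have hmem : ∀ x y, MemLp (fun x => if x ≤ c then g x else g' x) p (volume.restrict (Ioo x y)) :=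
    fun x y => MemLp.piecewise (s := Iic c) measurableSet_Iic ((h.memLp x y).restrict _)
      ((h'.memLp x y).restrict _)
  have hint : ∀ x y, IntervalIntegrable (fun x => if x ≤ c then g x else g' x) volume x y := by
    intro x y
    rw [intervalIntegrable_iff, uIoc, ← integrableOn_Icc_iff_integrableOn_Ioc,
      integrableOn_Icc_iff_integrableOn_Ioo]
    exact (hmem _ _).integrable hp
  refine ⟨Measurable.ite measurableSet_Iic h.measurable h'.measurable, hmem, fun x => ?_,
    fun x y => ?_⟩
  · rcases lt_trichotomy x c with hx | rfl | hx
    · rw [if_pos hx.le]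
      refine (h.hasDerivAt x).congr_of_eventuallyEq ?_
      filter_upwards [Iio_mem_nhds hx] with t ht using if_pos (le_of_lt ht)
    · rw [if_pos le_rfl, ← hasDerivWithinAt_univ, ← Iic_union_Ici (a := x)]
      refine HasDerivWithinAt.union ?_ ?_
      · exact (h.hasDerivAt x).hasDerivWithinAt.congr (fun t ht => if_pos ht) (if_pos le_rfl)
      · rw [hV]
        refine (h'.hasDerivAt x).hasDerivWithinAt.congr (fun t ht => ?_) ?_
        · rcases eq_or_lt_of_le (show x ≤ t from ht) with rfl | ht
          · rw [if_pos le_rfl, hU]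
          · exact if_neg (not_le.2 ht)
        · rw [if_pos le_rfl, hU]
    · rw [if_neg (not_le.2 hx)]
      refine (h'.hasDerivAt x).congr_of_eventuallyEq ?_
      filter_upwards [Ioi_mem_nhds hx] with t ht using if_neg (not_le.2 ht)
  · have key : ∀ y, (if y ≤ c then V y else V' y) - V c
        = ∫ t in c..y, if t ≤ c then g t else g' t := by
      intro y
      rcases le_or_gt y c with hy | hy
      · rw [if_pos hy, h.sub_eq c y]
        refine intervalIntegral.integral_congr_ae (ae_of_all _ fun t ht => ?_)
        rw [uIoc_of_ge hy] at ht
        rw [if_pos ht.2]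
      · rw [if_neg (not_le.2 hy), hV, h'.sub_eq c y]
        refine intervalIntegral.integral_congr_ae (ae_of_all _ fun t ht => ?_)
        rw [uIoc_of_le hy.le] at ht
        rw [if_neg (not_le.2 ht.1)]
    rw [← intervalIntegral.integral_add_adjacent_intervals (hint x c) (hint c y),
      intervalIntegral.integral_symm, ← key x, ← key y]
    ring

end TwicePrimitive

theorem map_affine_restrict_Ioo {k : ℝ} (hk : 0 < k) (m s t : ℝ) :
    Measure.map (fun x => k * x + m) (volume.restrict (Ioo s t))
      = ENNReal.ofReal k⁻¹ • volume.restrict (Ioo (k * s + m) (k * t + m)) := by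
  have hm : Measurable fun x : ℝ => k * x + m := by fun_prop
  have h1 : Measure.map (fun x : ℝ => k * x + m) volume = ENNReal.ofReal k⁻¹ • volume := by
    have h2 : (fun x : ℝ => k * x + m) = (fun x => x + m) ∘ (fun x => k * x) := rfl
    rw [h2, ← Measure.map_map (by fun_prop) (by fun_prop), Real.map_volume_mul_left hk.ne',
      Measure.map_smul, map_add_right_eq_self, abs_of_pos (inv_pos.2 hk)]
  have h3 : Ioo s t = (fun x => k * x + m) ⁻¹' Ioo (k * s + m) (k * t + m) := by
    ext x
    simp only [mem_Ioo, mem_preimage, add_lt_add_iff_right, mul_lt_mul_iff_right₀ hk]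
  rw [h3, ← Measure.restrict_map hm measurableSet_Ioo, h1, Measure.restrict_smul]

theorem measurableEmbedding_affine {k : ℝ} (hk : k ≠ 0) (m : ℝ) :
    MeasurableEmbedding fun x : ℝ => k * x + m :=
  (measurableEmbedding_addRight m).comp (measurableEmbedding_mulLeft₀ hk)

theorem TwicePrimitive.comp_affine {p : ℝ≥0∞} {U V g : ℝ → ℝ} (h : TwicePrimitive p U V g) {k : ℝ}
    (hk : 0 < k) (m : ℝ) :
    TwicePrimitive p (fun x => U (k * x + m)) (fun x => k * V (k * x + m))
      (fun x => k ^ 2 * g (k * x + m)) := by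
  refine ⟨(h.measurable.comp (by fun_prop)).const_mul _, fun x y => ?_, fun x => ?_, fun x y => ?_⟩
  · refine MemLp.const_mul ?_ _
    refine (measurableEmbedding_affine hk.ne' m).memLp_map_measure_iff.1 ?_
    rw [map_affine_restrict_Ioo hk]
    exact (h.memLp _ _).smul_measure ENNReal.ofReal_ne_top
  · have h1 : HasDerivAt (fun x : ℝ => k * x + m) k x := by
      simpa using ((hasDerivAt_id x).const_mul k).add_const m
    have := (h.hasDerivAt (k * x + m)).comp x h1
    rwa [mul_comm] at this
  · rw [intervalIntegral.integral_const_mul, intervalIntegral.integral_comp_mul_add _ hk.ne',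
      ← h.sub_eq, smul_eq_mul]
    field_simp

/-- The energy `∫_S ε⁻¹ (U² - 1)² + ε³ g²`, where `g` is the second derivative of `U`. -/
def localEnergy (ε : ℝ) (U g : ℝ → ℝ) (S : Set ℝ) : ℝ≥0∞ :=
  ∫⁻ x in S, ENNReal.ofReal (ε⁻¹ * (U x ^ 2 - 1) ^ 2 + ε ^ 3 * |g x| ^ 2)

theorem localEnergy_mono {ε : ℝ} {U g : ℝ → ℝ} {S T : Set ℝ} (h : S ⊆ T) :
    localEnergy ε U g S ≤ localEnergy ε U g T :=
  lintegral_mono_set h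

theorem localEnergy_congr {ε : ℝ} {U g U' g' : ℝ → ℝ} {S : Set ℝ} (hS : MeasurableSet S)
    (hU : ∀ x ∈ S, U x = U' x) (hg : ∀ x ∈ S, g x = g' x) :
    localEnergy ε U g S = localEnergy ε U' g' S :=
  setLIntegral_congr_fun hS fun x hx => by simp only [hU x hx, hg x hx]

theorem localEnergy_neg {ε : ℝ} {U g : ℝ → ℝ} {S : Set ℝ} :
    localEnergy ε (fun x => -U x) (fun x => -g x) S = localEnergy ε U g S := by
  simp [localEnergy]

/-- The energy on adjacent intervals is additive. -/
theorem localEnergy_Ioo_add {ε : ℝ} {U g : ℝ → ℝ} {x y z : ℝ} (hxy : x ≤ y) (hyz : y ≤ z) :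
    localEnergy ε U g (Ioo x y) + localEnergy ε U g (Ioo y z) = localEnergy ε U g (Ioo x z) := by
  simp only [localEnergy, restrict_Ioo_eq_restrict_Ioc]
  rw [← Ioc_union_Ioc_eq_Ioc hxy hyz, lintegral_union measurableSet_Ioc]
  exact Ioc_disjoint_Ioc_of_le le_rfl

/-- The change of variables `x ↦ k x + m` multiplies the parameter of the energy by `k`. -/
theorem localEnergy_comp_affine {ε : ℝ} {U g : ℝ → ℝ} {k : ℝ} (hk : 0 < k) (m s t : ℝ) :
    localEnergy ε (fun x => U (k * x + m)) (fun x => k ^ 2 * g (k * x + m)) (Ioo s t)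
      = localEnergy (ε * k) U g (Ioo (k * s + m) (k * t + m)) := by
  have h1 : localEnergy ε (fun x => U (k * x + m)) (fun x => k ^ 2 * g (k * x + m)) (Ioo s t)
      = ∫⁻ x, ENNReal.ofReal (ε⁻¹ * (U x ^ 2 - 1) ^ 2 + ε ^ 3 * |k ^ 2 * g x| ^ 2)
        ∂(Measure.map (fun x => k * x + m) (volume.restrict (Ioo s t))) := by
    rw [(measurableEmbedding_affine hk.ne' m).lintegral_map]
    rfl
  rw [h1, map_affine_restrict_Ioo hk, lintegral_smul_measure, smul_eq_mul,
    ← lintegral_const_mul' _ _ ENNReal.ofReal_ne_top, localEnergy]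
  congr 1
  funext x
  rw [← ENNReal.ofReal_mul (inv_pos.2 hk).le]
  congr 1
  rw [sq_abs, sq_abs]
  field_simp

/-! ### The scale invariant functional and the optimal scale -/

/-- The two integrals in the energy, weighted by the scale `ε`. -/
theorem TwicePrimitive.localEnergy_eq {p : ℝ≥0∞} {U V g : ℝ → ℝ} (h : TwicePrimitive p U V g)
    {ε : ℝ} (hε : 0 < ε) (S : Set ℝ) :
    localEnergy ε U g S = ENNReal.ofReal ε⁻¹ * (∫⁻ x in S, ENNReal.ofReal ((U x ^ 2 - 1) ^ 2))
      + ENNReal.ofReal (ε ^ 3) * ∫⁻ x in S, ENNReal.ofReal (|g x| ^ 2) := by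
  have hU := h.continuous
  rw [← lintegral_const_mul' _ _ ENNReal.ofReal_ne_top,
    ← lintegral_const_mul' _ _ ENNReal.ofReal_ne_top, ← lintegral_add_left, localEnergy]
  · congr 1
    funext x
    rw [← ENNReal.ofReal_mul (by positivity), ← ENNReal.ofReal_mul (by positivity),
      ← ENNReal.ofReal_add (by positivity) (by positivity)]
  · fun_prop

/-- For real `x, y > 0` the fourth powers `A = x⁴`, `B = y⁴` turn the fractional powers in `Phi` into
the monomial `x³ y`. -/
theorem ofReal_pow_rpow {x y : ℝ} (hx : 0 < x) (hy : 0 < y) :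
    ENNReal.ofReal (x ^ 4) ^ (3 / 4 : ℝ) * ENNReal.ofReal (y ^ 4) ^ (1 / 4 : ℝ)
      = ENNReal.ofReal (x ^ 3 * y) := by
  rw [ENNReal.ofReal_rpow_of_pos (by positivity), ENNReal.ofReal_rpow_of_pos (by positivity),
    ← ENNReal.ofReal_mul (by positivity)]
  congr 2
  · rw [← Real.rpow_natCast x 4, ← Real.rpow_mul hx.le, ← Real.rpow_natCast x 3]
    norm_num
  · rw [← Real.rpow_natCast y 4, ← Real.rpow_mul hy.le]
    norm_num

theorem exists_pow_four {A : ℝ≥0∞} (h0 : A ≠ 0) (ht : A ≠ ⊤) :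
    ∃ x : ℝ, 0 < x ∧ A = ENNReal.ofReal (x ^ 4) := by
  have hA := ENNReal.toReal_pos h0 ht
  refine ⟨A.toReal ^ (1 / 4 : ℝ), by positivity, ?_⟩
  rw [← Real.rpow_natCast, ← Real.rpow_mul hA.le]
  norm_num
  exact (ENNReal.ofReal_toReal ht).symm

theorem exists_fourth_root_three : ∃ t : ℝ, 0 < t ∧ t ^ 4 = 3 ∧ (3 : ℝ) ^ (3 / 4 : ℝ) = t ^ 3 := by
  refine ⟨3 ^ (1 / 4 : ℝ), by positivity, ?_, ?_⟩
  · rw [← Real.rpow_natCast, ← Real.rpow_mul (by norm_num)]; norm_num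
  · rw [← Real.rpow_natCast, ← Real.rpow_mul (by norm_num)]; norm_num

/-- Young's inequality behind the constant in `alpha`. -/
theorem two_mul_rpow_le (A B : ℝ≥0∞) {ε : ℝ} (hε : 0 < ε) :
    2 * (ENNReal.ofReal (2 / 3 ^ (3 / 4 : ℝ)) * (A ^ (3 / 4 : ℝ) * B ^ (1 / 4 : ℝ)))
      ≤ ENNReal.ofReal ε⁻¹ * A + ENNReal.ofReal (ε ^ 3) * B := by
  have h1 : ENNReal.ofReal ε⁻¹ ≠ 0 := by simpa using hε
  have h2 : ENNReal.ofReal (ε ^ 3) ≠ 0 := by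
    simpa using pow_pos hε 3
  by_cases hA : A = ⊤
  · simp [hA, ENNReal.mul_top h1]
  by_cases hB : B = ⊤
  · simp [hB, ENNReal.mul_top h2]
  by_cases hA0 : A = 0
  · simp [hA0]
  by_cases hB0 : B = 0
  · simp [hB0]
  obtain ⟨x, hx, rfl⟩ := exists_pow_four hA0 hA
  obtain ⟨y, hy, rfl⟩ := exists_pow_four hB0 hB
  obtain ⟨t, ht, ht4, ht3⟩ := exists_fourth_root_three
  rw [ofReal_pow_rpow hx hy, ht3, ← ENNReal.ofReal_mul (by positivity),
    ← ENNReal.ofReal_mul (by positivity), ← ENNReal.ofReal_mul (by positivity),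
    ← ENNReal.ofReal_ofNat 2, ← ENNReal.ofReal_mul (by positivity),
    ← ENNReal.ofReal_add (by positivity) (by positivity)]
  apply ENNReal.ofReal_le_ofReal
  have hz : ∃ z : ℝ, 0 < z ∧ ε * z = x := ⟨x / ε, by positivity, by field_simp⟩
  obtain ⟨z, hz, rfl⟩ := hz
  -- with `a = z` and `b = t y` the claim is `4 a³ b ≤ 3 a⁴ + b⁴`
  have key : 4 * (z ^ 3 * (t * y)) ≤ 3 * z ^ 4 + (t * y) ^ 4 := by
    nlinarith [mul_nonneg (sq_nonneg (z - t * y)) (add_nonneg (sq_nonneg (z + t * y))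
      (mul_nonneg (by norm_num : (0:ℝ) ≤ 2) (sq_nonneg z)))]
  have h3 : 2 * (2 / t ^ 3 * ((ε * z) ^ 3 * y)) = ε ^ 3 / 3 * (4 * (z ^ 3 * (t * y))) := by
    rw [← ht4]; field_simp; ring
  have h4 : ε⁻¹ * (ε * z) ^ 4 + ε ^ 3 * y ^ 4 = ε ^ 3 / 3 * (3 * z ^ 4 + (t * y) ^ 4) := by
    rw [mul_pow t, ht4]; field_simp
  rw [h3, h4]
  gcongr

/-- Young's inequality is an equality for a suitable scale. -/
theorem exists_scale_lt {A B c : ℝ≥0∞} (hA0 : A ≠ 0) (hA : A ≠ ⊤)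
    (hc : 2 * (ENNReal.ofReal (2 / 3 ^ (3 / 4 : ℝ)) * (A ^ (3 / 4 : ℝ) * B ^ (1 / 4 : ℝ))) < c) :
    ∃ ε : ℝ, 0 < ε ∧ ENNReal.ofReal ε⁻¹ * A + ENNReal.ofReal (ε ^ 3) * B < c := by
  obtain ⟨t, ht, ht4, ht3⟩ := exists_fourth_root_three
  obtain ⟨x, hx, rfl⟩ := exists_pow_four hA0 hA
  have hB : B ≠ ⊤ := by
    rintro rfl
    refine not_top_lt (lt_of_eq_of_lt ?_ hc)
    rw [ENNReal.top_rpow_of_pos (by norm_num), ENNReal.mul_top, ENNReal.mul_top, ENNReal.mul_top]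
    · norm_num
    · rw [ht3]; simp; positivity
    · rw [ENNReal.ofReal_rpow_of_pos (by positivity)]; simp; positivity
  by_cases hB0 : B = 0
  · -- no bending energy: a large scale makes the other term small
    subst hB0
    have hc0 : 0 < c := lt_of_le_of_lt zero_le hc
    obtain ⟨r, hr, hrc⟩ : ∃ r : ℝ, 0 < r ∧ ENNReal.ofReal r < c := by
      obtain ⟨q, hq0, hqc⟩ := ENNReal.lt_iff_exists_nnreal_btwn.1 hc0
      exact ⟨q, by exact_mod_cast hq0, by simpa using hqc⟩
    refine ⟨x ^ 4 / r, by positivity, ?_⟩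
    rw [mul_zero, add_zero, ← ENNReal.ofReal_mul (by positivity)]
    convert hrc using 2
    field_simp
  obtain ⟨y, hy, rfl⟩ := exists_pow_four hB0 hB
  refine ⟨x / (t * y), by positivity, lt_of_eq_of_lt ?_ hc⟩
  rw [ofReal_pow_rpow hx hy, ht3, ← ENNReal.ofReal_mul (by positivity),
    ← ENNReal.ofReal_mul (by positivity), ← ENNReal.ofReal_mul (by positivity),
    ← ENNReal.ofReal_ofNat 2, ← ENNReal.ofReal_mul (by positivity),
    ← ENNReal.ofReal_add (by positivity) (by positivity)]
  congr 1
  have h4 : (x / (t * y))⁻¹ * x ^ 4 + (x / (t * y)) ^ 3 * y ^ 4 = x ^ 3 * y * (t ^ 4 + 1) / t ^ 3 := by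
    field_simp
  rw [h4, ht4]
  field_simp
  norm_num

/-! ### Transition profiles -/

/-- `W` is a transition from `-1` to `1`, constant to the left of `0` and to the right of `1`. -/
structure IsProfile (p : ℝ≥0∞) (W V g : ℝ → ℝ) : Prop where
  twicePrimitive : TwicePrimitive p W V g
  left : ∀ x ≤ 0, W x = -1
  right : ∀ x, 1 ≤ x → W x = 1
  eq_zero : ∀ x, x ∉ Ioo (0 : ℝ) 1 → g x = 0

theorem TwicePrimitive.mem_family {p : ℝ≥0∞} (hp : 1 ≤ p) {W V g : ℝ → ℝ}
    (h : TwicePrimitive p W V g) (h0 : W 0 = -1) (h1 : W 1 = 1) (h0' : V 0 = 0) (h1' : V 1 = 0) :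
    W ∈ family p := by
  have hV := h.continuous_deriv hp
  refine ⟨h.memSobolev hp one_pos (ae_eq_refl _), (h.contDiff hp).contDiffOn, ?_, ?_, ?_, ?_⟩
  · simpa only [h0] using (h.continuous.tendsto 0).mono_left nhdsWithin_le_nhds
  · simpa only [h1] using (h.continuous.tendsto 1).mono_left nhdsWithin_le_nhds
  · simpa only [h.deriv_eq, h0'] using (hV.tendsto 0).mono_left nhdsWithin_le_nhds
  · simpa only [h.deriv_eq, h1'] using (hV.tendsto 1).mono_left nhdsWithin_le_nhds

theorem TwicePrimitive.Phi_eq {p : ℝ≥0∞} (hp : 1 ≤ p) {W V g : ℝ → ℝ}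
    (h : TwicePrimitive p W V g) :
    Phi p W = (∫⁻ y in Ioo (0 : ℝ) 1, ENNReal.ofReal ((W y ^ 2 - 1) ^ 2)) ^ (3 / 4 : ℝ) *
      (∫⁻ y in Ioo (0 : ℝ) 1, ENNReal.ofReal (|g y| ^ 2)) ^ (1 / 4 : ℝ) := by
  rw [Phi]
  congr 2
  refine lintegral_congr_ae ?_
  filter_upwards [h.weakDeriv_ae_eq hp one_pos (ae_eq_refl _)] with x hx
  rw [hx]

/-- The cost of a full transition: the energy on any interval on which `W` passes from `-1` to `1`
with vanishing slopes at both ends is at least `2 α`. -/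
theorem TwicePrimitive.two_mul_alpha_le {p : ℝ≥0∞} (hp : 1 ≤ p) {W V g : ℝ → ℝ}
    (h : TwicePrimitive p W V g) {c d ε : ℝ} (hcd : c < d) (hε : 0 < ε) (h0 : W c = -1)
    (h1 : W d = 1) (h0' : V c = 0) (h1' : V d = 0) :
    2 * alpha p ≤ localEnergy ε W g (Ioo c d) := by
  have hk : 0 < d - c := sub_pos.2 hcd
  have h2 := h.comp_affine hk c
  have hmem := h2.mem_family hp (by simpa using h0) (by simpa using h1) (by simp [h0'])
    (by simp [h1'])
  have he := localEnergy_comp_affine (ε := ε / (d - c)) (U := W) (g := g) hk c 0 1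
  rw [div_mul_cancel₀ _ hk.ne', mul_zero, mul_one, zero_add, sub_add_cancel] at he
  rw [← he, h2.localEnergy_eq (div_pos hε hk)]
  refine le_trans ?_ (two_mul_rpow_le _ _ (div_pos hε hk))
  rw [← h2.Phi_eq hp, alpha]
  gcongr
  exact iInf₂_le _ hmem

/-- Every member of the family extends to a profile on `ℝ`. -/
theorem exists_isProfile {p : ℝ≥0∞} (hp : 1 ≤ p) {w : ℝ → ℝ} (hw : w ∈ family p) :
    ∃ W V g, IsProfile p W V g ∧ Phi p w = Phi p W := by
  obtain ⟨hS, hC, hl, hr, hl', hr'⟩ := hw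
  obtain ⟨U, V, g, h, hg0, hU, hwd⟩ := hS.exists_twicePrimitive hp one_pos
  have hV := h.continuous_deriv hp
  have hEq : EqOn w U (Ioo 0 1) :=
    Measure.eqOn_open_of_ae_eq hU isOpen_Ioo hC.continuousOn h.continuous.continuousOn
  have hEq' : EqOn (deriv w) V (Ioo 0 1) := fun x hx => by
    rw [(hEq.eventuallyEq_of_mem (isOpen_Ioo.mem_nhds hx)).deriv_eq, h.deriv_eq]
  have m0 : Ioo (0 : ℝ) 1 ∈ 𝓝[>] (0 : ℝ) := Ioo_mem_nhdsGT one_pos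
  have m1 : Ioo (0 : ℝ) 1 ∈ 𝓝[<] (1 : ℝ) := Ioo_mem_nhdsLT one_pos
  have hU0 : U 0 = -1 := tendsto_nhds_unique
    ((h.continuous.tendsto 0).mono_left nhdsWithin_le_nhds)
    (hl.congr' (hEq.eventuallyEq_of_mem m0))
  have hU1 : U 1 = 1 := tendsto_nhds_unique
    ((h.continuous.tendsto 1).mono_left nhdsWithin_le_nhds)
    (hr.congr' (hEq.eventuallyEq_of_mem m1))
  have hV0 : V 0 = 0 := tendsto_nhds_unique
    ((hV.tendsto 0).mono_left nhdsWithin_le_nhds)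
    (hl'.congr' (hEq'.eventuallyEq_of_mem m0))
  have hV1 : V 1 = 0 := tendsto_nhds_unique
    ((hV.tendsto 1).mono_left nhdsWithin_le_nhds)
    (hr'.congr' (hEq'.eventuallyEq_of_mem m1))
  have h01 : ¬ (1 : ℝ) ≤ 0 := by norm_num
  have hG := ((TwicePrimitive.const (-1)).glue hp h (c := 0) hU0.symm hV0.symm).glue hp
    (TwicePrimitive.const 1) (c := 1) (by simp [h01, hU1]) (by simp [h01, hV1])
  have hGin : ∀ x ∈ Ioo (0 : ℝ) 1, (if x ≤ 1 then if x ≤ 0 then -1 else U x else 1) = U x :=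
    fun x hx => by rw [if_pos hx.2.le, if_neg (not_le.2 hx.1)]
  have hgin : ∀ x ∈ Ioo (0 : ℝ) 1, (if x ≤ 1 then if x ≤ 0 then 0 else g x else 0) = g x :=
    fun x hx => by rw [if_pos hx.2.le, if_neg (not_le.2 hx.1)]
  refine ⟨_, _, _, ⟨hG, fun x hx => ?_, fun x hx => ?_, fun x hx => ?_⟩, ?_⟩
  · rw [if_pos (hx.trans zero_le_one), if_pos hx]
  · rcases eq_or_lt_of_le hx with rfl | hx
    · rw [if_pos le_rfl, if_neg h01, hU1]
    · rw [if_neg (not_le.2 hx)]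
  · rw [hg0 x hx, ite_self, ite_self]
  · rw [hG.Phi_eq hp, Phi]
    congr 2
    · refine setLIntegral_congr_fun measurableSet_Ioo fun x hx => ?_
      simp only [hGin x hx, hEq hx]
    · refine lintegral_congr_ae ?_
      filter_upwards [hwd, ae_restrict_mem measurableSet_Ioo] with x hx hxm
      rw [hx, hgin x hxm]

namespace IsProfile

variable {p : ℝ≥0∞} {W V g : ℝ → ℝ}

theorem exists_zero (h : IsProfile p W V g) : ∃ x ∈ Ioo (0 : ℝ) 1, W x = 0 := by
  have := intermediate_value_Ioo (zero_le_one (α := ℝ)) h.twicePrimitive.continuous.continuousOn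
  rw [h.left 0 le_rfl, h.right 1 le_rfl] at this
  exact this ⟨by norm_num, by norm_num⟩

theorem lintegral_ne_zero (h : IsProfile p W V g) :
    ∫⁻ y in Ioo (0 : ℝ) 1, ENNReal.ofReal ((W y ^ 2 - 1) ^ 2) ≠ 0 := by
  have hW := h.twicePrimitive.continuous
  intro h0
  rw [lintegral_eq_zero_iff (by fun_prop)] at h0
  have h1 : (fun y => (W y ^ 2 - 1) ^ 2) =ᵐ[volume.restrict (Ioo (0 : ℝ) 1)] fun _ => 0 := by
    filter_upwards [h0] with x hx
    simp only [Pi.zero_apply, ENNReal.ofReal_eq_zero] at hx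
    exact le_antisymm hx (sq_nonneg _)
  have h2 := Measure.eqOn_open_of_ae_eq h1 isOpen_Ioo (by fun_prop) (by fun_prop)
  obtain ⟨x, hx, hx0⟩ := h.exists_zero
  have := h2 hx
  simp [hx0] at this

theorem lintegral_ne_top (h : IsProfile p W V g) :
    ∫⁻ y in Ioo (0 : ℝ) 1, ENNReal.ofReal ((W y ^ 2 - 1) ^ 2) ≠ ⊤ := by
  have hW := h.twicePrimitive.continuous
  have h1 : MemLp (fun y => (W y ^ 2 - 1) ^ 2) 1 (volume.restrict (Ioo (0 : ℝ) 1)) :=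
    memLp_restrict_Ioo_of_continuous (by fun_prop)
  exact (memLp_one_iff_integrable.1 h1).lintegral_lt_top.ne

/-- A profile can be rescaled so that its energy comes as close as desired to the optimal value. -/
theorem exists_localEnergy_lt (hp : 1 ≤ p) (h : IsProfile p W V g) {c : ℝ≥0∞}
    (hc : 2 * (ENNReal.ofReal (2 / 3 ^ (3 / 4 : ℝ)) * Phi p W) < c) :
    ∃ ε : ℝ, 0 < ε ∧ localEnergy ε W g (Ioo 0 1) < c := by
  rw [h.twicePrimitive.Phi_eq hp] at hc
  obtain ⟨ε, hε, hlt⟩ := exists_scale_lt h.lintegral_ne_zero h.lintegral_ne_top hc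
  exact ⟨ε, hε, by rwa [h.twicePrimitive.localEnergy_eq hε]⟩

end IsProfile

theorem exists_isProfile_localEnergy_lt {p : ℝ≥0∞} (hp : 1 ≤ p) {c : ℝ≥0∞}
    (hc : 2 * alpha p < c) :
    ∃ W V g, IsProfile p W V g ∧ ∃ ε : ℝ, 0 < ε ∧ localEnergy ε W g (Ioo 0 1) < c := by
  have h1 : ∃ w ∈ family p, 2 * (ENNReal.ofReal (2 / 3 ^ (3 / 4 : ℝ)) * Phi p w) < c := by
    by_contra hcon
    push Not at hcon
    refine absurd hc (not_lt.2 ?_)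
    rw [alpha, ENNReal.mul_iInf_of_ne, ENNReal.mul_iInf_of_ne] <;> try simp
    · intro w
      rw [ENNReal.mul_iInf_of_ne, ENNReal.mul_iInf_of_ne] <;> try simp
      · exact hcon w
      · positivity
    · positivity
  obtain ⟨w, hw, hlt⟩ := h1
  obtain ⟨W, V, g, h, hPhi⟩ := exists_isProfile hp hw
  exact ⟨W, V, g, h, h.exists_localEnergy_lt hp (hPhi ▸ hlt)⟩

/-! ### Small energy on an interval forces the function into a well -/

section UnitInterval

variable {p : ℝ≥0∞} {U V g : ℝ → ℝ} {c τ : ℝ}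

theorem lintegral_abs_sq_le_localEnergy (S : Set ℝ) :
    ∫⁻ x in S, ENNReal.ofReal (|g x| ^ 2) ≤ localEnergy 1 U g S :=
  lintegral_mono fun x => ENNReal.ofReal_le_ofReal (by
    have := sq_nonneg (U x ^ 2 - 1)
    norm_num
    positivity)

theorem lintegral_well_le_localEnergy (S : Set ℝ) :
    ∫⁻ x in S, ENNReal.ofReal ((U x ^ 2 - 1) ^ 2) ≤ localEnergy 1 U g S :=
  lintegral_mono fun x => ENNReal.ofReal_le_ofReal (by
    norm_num
    positivity)

/-- The slope oscillates by at most `τ`, since `|g| ≤ g² / (2 τ) + τ / 2`. -/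
theorem TwicePrimitive.abs_sub_le_of_localEnergy_le (h : TwicePrimitive p U V g) (hτ : 0 < τ)
    (hE : localEnergy 1 U g (Ioo c (c + 1)) ≤ ENNReal.ofReal (τ ^ 2)) {x y : ℝ}
    (hx : x ∈ Icc c (c + 1)) (hy : y ∈ Icc c (c + 1)) : |V y - V x| ≤ τ := by
  rw [h.sub_eq x y]
  have hsub : uIoc x y ⊆ Ioc c (c + 1) := by
    rintro t ⟨ht1, ht2⟩
    exact ⟨(le_min hx.1 hy.1).trans_lt ht1, ht2.trans (max_le hx.2 hy.2)⟩
  have h1 : ‖∫ t in x..y, g t‖ₑ ≤ ∫⁻ t in Ioo c (c + 1), ‖g t‖ₑ := by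
    have h2 : ‖∫ t in x..y, g t‖ₑ = ‖∫ t in uIoc x y, g t‖ₑ := by
      rw [← ofReal_norm, ← ofReal_norm, intervalIntegral.norm_integral_eq_norm_integral_uIoc]
    rw [h2, restrict_Ioo_eq_restrict_Ioc]
    exact (enorm_integral_le_lintegral_enorm _).trans (lintegral_mono_set hsub)
  have h3 : ∫⁻ t in Ioo c (c + 1), ‖g t‖ₑ ≤ ENNReal.ofReal τ := by
    calc ∫⁻ t in Ioo c (c + 1), ‖g t‖ₑ
        ≤ ∫⁻ t in Ioo c (c + 1), (ENNReal.ofReal (2 * τ)⁻¹ * ENNReal.ofReal (|g t| ^ 2)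
            + ENNReal.ofReal (τ / 2)) := by
          refine lintegral_mono fun t => ?_
          rw [← ENNReal.ofReal_mul (by positivity), ← ENNReal.ofReal_add (by positivity)
            (by positivity), ← ofReal_norm, Real.norm_eq_abs]
          apply ENNReal.ofReal_le_ofReal
          have : (2 * τ)⁻¹ * |g t| ^ 2 + τ / 2 - |g t| = (2 * τ)⁻¹ * (|g t| - τ) ^ 2 := by
            field_simp; ring
          have h4 : 0 ≤ (2 * τ)⁻¹ * (|g t| - τ) ^ 2 := by positivity
          linarith
      _ = ENNReal.ofReal (2 * τ)⁻¹ * (∫⁻ t in Ioo c (c + 1), ENNReal.ofReal (|g t| ^ 2))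
            + ENNReal.ofReal (τ / 2) := by
          rw [lintegral_add_right _ measurable_const,
            lintegral_const_mul' _ _ ENNReal.ofReal_ne_top]
          simp
      _ ≤ ENNReal.ofReal (2 * τ)⁻¹ * ENNReal.ofReal (τ ^ 2) + ENNReal.ofReal (τ / 2) := by
          gcongr
          exact (lintegral_abs_sq_le_localEnergy _).trans hE
      _ = ENNReal.ofReal τ := by
          rw [← ENNReal.ofReal_mul (by positivity), ← ENNReal.ofReal_add (by positivity)
            (by positivity)]
          congr 1
          field_simp
          norm_num
  have h5 := h1.trans h3
  rwa [← ofReal_norm, ENNReal.ofReal_le_ofReal_iff hτ.le, Real.norm_eq_abs] at h5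

/-- Chebyshev's inequality on a fifth of the interval. -/
theorem exists_abs_abs_sub_one_le (hτ : 0 < τ)
    (hE : localEnergy 1 U g (Ioo c (c + 1)) ≤ ENNReal.ofReal (τ ^ 2)) {s : ℝ}
    (hs : c ≤ s) (hs' : s + 1 / 5 ≤ c + 1) : ∃ ξ ∈ Ioo s (s + 1 / 5), |(|U ξ| - 1)| ≤ 3 * τ := by
  have h1 : ∃ ξ ∈ Ioo s (s + 1 / 5), (U ξ ^ 2 - 1) ^ 2 ≤ 6 * τ ^ 2 := by
    by_contra hcon
    push Not at hcon
    have h2 : ∫⁻ _ in Ioo s (s + 1 / 5), ENNReal.ofReal (6 * τ ^ 2)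
        ≤ ∫⁻ x in Ioo s (s + 1 / 5), ENNReal.ofReal ((U x ^ 2 - 1) ^ 2) :=
      setLIntegral_mono' measurableSet_Ioo fun x hx => ENNReal.ofReal_le_ofReal (hcon x hx).le
    have h3 := h2.trans ((lintegral_mono_set (Ioo_subset_Ioo hs hs')).trans
      ((lintegral_well_le_localEnergy (g := g) _).trans hE))
    rw [setLIntegral_const, Real.volume_Ioo, add_sub_cancel_left,
      ← ENNReal.ofReal_mul (by positivity), ENNReal.ofReal_le_ofReal_iff (by positivity)] at h3
    nlinarith [pow_pos hτ 2]
  obtain ⟨ξ, hξ, h2⟩ := h1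
  refine ⟨ξ, hξ, abs_le_of_sq_le_sq ?_ (by positivity)⟩
  have h3 : (U ξ ^ 2 - 1) ^ 2 = (|U ξ| - 1) ^ 2 * (|U ξ| + 1) ^ 2 := by
    rw [← sq_abs (U ξ)]; ring
  have h4 : 1 ≤ (|U ξ| + 1) ^ 2 := by nlinarith [abs_nonneg (U ξ)]
  nlinarith [sq_nonneg (|U ξ| - 1), pow_pos hτ 2]

/-- If the energy on a unit interval is at most `τ²`, then on this interval the slope is `O(τ)` and
the function is within `O(τ)` of one of the wells `±1`. Among three well separated points close to
the wells, two are close to the same well, so the slope is small somewhere. -/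
theorem TwicePrimitive.near_well (h : TwicePrimitive p U V g) (hτ : 0 < τ)
    (hE : localEnergy 1 U g (Ioo c (c + 1)) ≤ ENNReal.ofReal (τ ^ 2)) {x : ℝ}
    (hx : x ∈ Icc c (c + 1)) : |V x| ≤ 31 * τ ∧ |(|U x| - 1)| ≤ 34 * τ := by
  obtain ⟨ξ₁, hξ₁, h₁⟩ := exists_abs_abs_sub_one_le hτ hE (s := c) le_rfl (by linarith)
  obtain ⟨ξ₂, hξ₂, h₂⟩ := exists_abs_abs_sub_one_le hτ hE (s := c + 2 / 5) (by linarith)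
    (by linarith)
  obtain ⟨ξ₃, hξ₃, h₃⟩ := exists_abs_abs_sub_one_le hτ hE (s := c + 4 / 5) (by linarith)
    (by linarith)
  rw [mem_Ioo] at hξ₁ hξ₂ hξ₃
  have hpair : ∃ s t, c ≤ s ∧ s + 1 / 5 ≤ t ∧ t ≤ c + 1 ∧ |U t - U s| ≤ 6 * τ := by
    have hpos : ∀ {s t : ℝ}, |(|U s| - 1)| ≤ 3 * τ → |(|U t| - 1)| ≤ 3 * τ → 0 ≤ U s → 0 ≤ U t →
        |U t - U s| ≤ 6 * τ := fun hs ht h0s h0t => by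
      rw [abs_of_nonneg h0s, abs_le] at hs
      rw [abs_of_nonneg h0t, abs_le] at ht
      rw [abs_le]
      constructor <;> linarith
    have hneg : ∀ {s t : ℝ}, |(|U s| - 1)| ≤ 3 * τ → |(|U t| - 1)| ≤ 3 * τ → U s ≤ 0 → U t ≤ 0 →
        |U t - U s| ≤ 6 * τ := fun hs ht h0s h0t => by
      rw [abs_of_nonpos h0s, abs_le] at hs
      rw [abs_of_nonpos h0t, abs_le] at ht
      rw [abs_le]
      constructor <;> linarith
    have h₁₂ : ξ₁ + 1 / 5 ≤ ξ₂ := by linarith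
    have h₂₃ : ξ₂ + 1 / 5 ≤ ξ₃ := by linarith
    have h₁₃ : ξ₁ + 1 / 5 ≤ ξ₃ := by linarith
    have h₂' : ξ₂ ≤ c + 1 := by linarith
    have h₃' : ξ₃ ≤ c + 1 := by linarith
    have h₂'' : c ≤ ξ₂ := by linarith
    rcases le_total 0 (U ξ₁) with s₁ | s₁ <;> rcases le_total 0 (U ξ₂) with s₂ | s₂ <;>
      rcases le_total 0 (U ξ₃) with s₃ | s₃
    · exact ⟨ξ₁, ξ₂, hξ₁.1.le, h₁₂, h₂', hpos h₁ h₂ s₁ s₂⟩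
    · exact ⟨ξ₁, ξ₂, hξ₁.1.le, h₁₂, h₂', hpos h₁ h₂ s₁ s₂⟩
    · exact ⟨ξ₁, ξ₃, hξ₁.1.le, h₁₃, h₃', hpos h₁ h₃ s₁ s₃⟩
    · exact ⟨ξ₂, ξ₃, h₂'', h₂₃, h₃', hneg h₂ h₃ s₂ s₃⟩
    · exact ⟨ξ₂, ξ₃, h₂'', h₂₃, h₃', hpos h₂ h₃ s₂ s₃⟩
    · exact ⟨ξ₁, ξ₃, hξ₁.1.le, h₁₃, h₃', hneg h₁ h₃ s₁ s₃⟩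
    · exact ⟨ξ₁, ξ₂, hξ₁.1.le, h₁₂, h₂', hneg h₁ h₂ s₁ s₂⟩
    · exact ⟨ξ₁, ξ₂, hξ₁.1.le, h₁₂, h₂', hneg h₁ h₂ s₁ s₂⟩
  obtain ⟨s, t, hs, hst, ht, hUst⟩ := hpair
  obtain ⟨ζ, hζ, hVζ⟩ := exists_hasDerivAt_eq_slope U V (show s < t by linarith)
    h.continuous.continuousOn (fun x _ => h.hasDerivAt x)
  have hζ' : ζ ∈ Icc c (c + 1) := ⟨by linarith [hζ.1], by linarith [hζ.2]⟩
  have hVζ' : |V ζ| ≤ 30 * τ := by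
    have hpos : 0 < t - s := by linarith
    rw [hVζ, abs_div, abs_of_pos hpos, div_le_iff₀ hpos]
    nlinarith
  have hV : ∀ y ∈ Icc c (c + 1), |V y| ≤ 31 * τ := fun y hy => by
    have h1 := h.abs_sub_le_of_localEnergy_le hτ hE hζ' hy
    have h2 := abs_add_le (V y - V ζ) (V ζ)
    rw [sub_add_cancel] at h2
    linarith
  refine ⟨hV x hx, ?_⟩
  have hξ₁' : ξ₁ ∈ Icc c (c + 1) := ⟨hξ₁.1.le, by linarith⟩
  have h1 : ‖U x - U ξ₁‖ ≤ 31 * τ * ‖x - ξ₁‖ :=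
    (convex_Icc c (c + 1)).norm_image_sub_le_of_norm_hasDerivWithin_le
      (fun y _ => (h.hasDerivAt y).hasDerivWithinAt) hV hξ₁' hx
  have h2 : ‖x - ξ₁‖ ≤ 1 := by
    rw [Real.norm_eq_abs, abs_le]
    constructor <;> linarith [hx.1, hx.2, hξ₁'.1, hξ₁'.2]
  have h3 : ‖U x - U ξ₁‖ ≤ 31 * τ := h1.trans (mul_le_of_le_one_right (by positivity) h2)
  have h4 := (abs_abs_sub_abs_le_abs_sub (U x) (U ξ₁)).trans h3
  have h5 := abs_add_le (|U x| - |U ξ₁|) (|U ξ₁| - 1)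
  rw [sub_add_sub_cancel] at h5
  linarith

end UnitInterval

theorem IsProfile.localEnergy_le {p : ℝ≥0∞} {W V g : ℝ → ℝ} (h : IsProfile p W V g) (ε : ℝ)
    (S : Set ℝ) : localEnergy ε W g S ≤ localEnergy ε W g (Ioo 0 1) := by
  have h1 : localEnergy ε W g S ≤ ∫⁻ x, ENNReal.ofReal
      (ε⁻¹ * (W x ^ 2 - 1) ^ 2 + ε ^ 3 * |g x| ^ 2) := setLIntegral_le_lintegral _ _
  refine h1.trans (le_of_eq ?_)
  rw [localEnergy, ← lintegral_indicator measurableSet_Ioo]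
  congr 1
  funext x
  by_cases hx : x ∈ Ioo (0 : ℝ) 1
  · rw [indicator_of_mem hx]
  · rw [indicator_of_notMem hx, h.eq_zero x hx]
    have hW : W x ^ 2 = 1 := by
      rcases le_or_gt x 0 with h0 | h0
      · rw [h.left x h0]; norm_num
      · rw [h.right x (by by_contra h1; exact hx ⟨h0, not_le.1 h1⟩)]; norm_num
    simp [hW]

/-- Transitions have positive cost: on a unit interval starting at a zero of a profile, the energy
is bounded from below. -/
theorem alpha_ne_zero {p : ℝ≥0∞} (hp : 1 ≤ p) : alpha p ≠ 0 := by
  intro h0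
  obtain ⟨W, V, g, h, ε, hε, hlt⟩ := exists_isProfile_localEnergy_lt hp
    (c := ENNReal.ofReal ((1 / 35) ^ 2)) (by rw [h0, mul_zero]; simp)
  obtain ⟨z, -, hz⟩ := h.exists_zero
  have hE : localEnergy 1 (fun x => W (ε * x + z)) (fun x => ε ^ 2 * g (ε * x + z)) (Ioo 0 (0 + 1))
      ≤ ENNReal.ofReal ((1 / 35) ^ 2) := by
    rw [localEnergy_comp_affine hε, one_mul]
    exact (h.localEnergy_le _ _).trans hlt.le
  have h1 := ((h.twicePrimitive.comp_affine hε z).near_well (by norm_num) hE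
    (x := 0) (by simp)).2
  rw [mul_zero, zero_add, hz] at h1
  norm_num at h1

theorem TwicePrimitive.near_well_scaled {p : ℝ≥0∞} {U V g : ℝ → ℝ} (h : TwicePrimitive p U V g)
    {ε τ x : ℝ} (hε : 0 < ε) (hτ : 0 < τ)
    (hE : localEnergy ε U g (Ioo x (x + ε)) ≤ ENNReal.ofReal (τ ^ 2)) :
    |ε * V x| ≤ 31 * τ ∧ |(|U x| - 1)| ≤ 34 * τ := by
  have hE' : localEnergy 1 (fun t => U (ε * t + x)) (fun t => ε ^ 2 * g (ε * t + x))
      (Ioo 0 (0 + 1)) ≤ ENNReal.ofReal (τ ^ 2) := by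
    rwa [localEnergy_comp_affine hε, one_mul, mul_zero, zero_add, zero_add, mul_one, add_comm ε]
  have h1 := (h.comp_affine hε x).near_well hτ hE' (x := 0) (by simp)
  simpa using h1

/-! ### The cost of an approximate transition -/

theorem hermite_density_le {m n s t η : ℝ} (hs : s ^ 2 = 1) (hη0 : 0 ≤ η) (hη : η ≤ 1 / 7)
    (hm : |m| ≤ 4 * η) (hn : |n| ≤ 3 * η) (t0 : 0 ≤ t) (t1 : t ≤ 1) :
    ((s + (m * t ^ 2 + n * t ^ 3)) ^ 2 - 1) ^ 2 + |2 * m + 6 * n * t| ^ 2 ≤ 1117 * η ^ 2 := by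
  have ht2 : |t ^ 2| ≤ 1 := by
    rw [abs_of_nonneg (sq_nonneg t)]; exact pow_le_one₀ t0 t1
  have ht3 : |t ^ 3| ≤ 1 := by
    rw [abs_of_nonneg (pow_nonneg t0 3)]; exact pow_le_one₀ t0 t1
  have ht1 : |t| ≤ 1 := by rwa [abs_of_nonneg t0]
  have hq : |m * t ^ 2 + n * t ^ 3| ≤ 7 * η := by
    refine (abs_add_le _ _).trans ?_
    rw [abs_mul, abs_mul]
    have := mul_le_of_le_one_right (abs_nonneg m) ht2
    have := mul_le_of_le_one_right (abs_nonneg n) ht3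
    linarith
  have hq2 : |2 * m + 6 * n * t| ≤ 26 * η := by
    refine (abs_add_le _ _).trans ?_
    rw [abs_mul, abs_mul, abs_mul, abs_of_pos (by norm_num : (0:ℝ) < 2),
      abs_of_pos (by norm_num : (0:ℝ) < 6)]
    have := mul_le_of_le_one_right (abs_nonneg n) ht1
    linarith
  generalize m * t ^ 2 + n * t ^ 3 = q at hq
  have h1 : (s + q) ^ 2 - 1 = q * (q + 2 * s) := by linear_combination hs
  have hs1 : |s| = 1 := by
    rw [← sq_eq_sq₀ (abs_nonneg _) zero_le_one, sq_abs, hs, one_pow]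
  have h2 : |q + 2 * s| ≤ 3 := by
    refine (abs_add_le _ _).trans ?_
    rw [abs_mul, hs1, abs_of_pos (by norm_num : (0:ℝ) < 2)]
    linarith
  have h3 : |q * (q + 2 * s)| ≤ 21 * η := by
    rw [abs_mul]
    have := mul_le_mul hq h2 (abs_nonneg _) (by linarith)
    linarith
  have h4 : (q * (q + 2 * s)) ^ 2 ≤ (21 * η) ^ 2 := by
    rw [← sq_abs]; gcongr
  have h5 : |2 * m + 6 * n * t| ^ 2 ≤ (26 * η) ^ 2 := by gcongr
  rw [h1]
  linarith

/-- Cubic Hermite interpolation on a unit interval: for `σ = ±1`, a cubic polynomial has value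
`s` and slope `0` at `c - σ`, and value `s + A` and slope `B` at `c`. If `s = ±1` and `A, B` are
at most `η`, its energy between these points is `O(η²)`. -/
theorem exists_hermite (p : ℝ≥0∞) {c σ s A B η : ℝ} (hσ : σ ^ 2 = 1) (hs : s ^ 2 = 1)
    (hη : η ≤ 1 / 7) (hA : |A| ≤ η) (hB : |B| ≤ η) :
    ∃ P P₁ P₂, TwicePrimitive p P P₁ P₂ ∧ P c = s + A ∧ P₁ c = B ∧ P (c - σ) = s ∧
      P₁ (c - σ) = 0 ∧ ∀ l r, r - l = 1 → (∀ x ∈ Ioo l r, σ * (x - c) + 1 ∈ Icc (0 : ℝ) 1) →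
        localEnergy 1 P P₂ (Ioo l r) ≤ ENNReal.ofReal (1117 * η ^ 2) := by
  have hη0 : 0 ≤ η := (abs_nonneg A).trans hA
  obtain ⟨m, hm⟩ : ∃ m, m = 3 * A - σ * B := ⟨_, rfl⟩
  obtain ⟨n, hn⟩ : ∃ n, n = σ * B - 2 * A := ⟨_, rfl⟩
  have hd : ∀ x, HasDerivAt (fun x : ℝ => σ * (x - c) + 1) σ x := fun x => by
    simpa using (((hasDerivAt_id x).sub_const c).const_mul σ).add_const 1
  refine ⟨fun x => s + (m * (σ * (x - c) + 1) ^ 2 + n * (σ * (x - c) + 1) ^ 3),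
    fun x => σ * (2 * m * (σ * (x - c) + 1) + 3 * n * (σ * (x - c) + 1) ^ 2),
    fun x => 2 * m + 6 * n * (σ * (x - c) + 1),
    TwicePrimitive.of_continuous (fun x => ?_) (fun x => ?_) (by fun_prop), ?_, ?_, ?_, ?_, ?_⟩
  · have := ((((hd x).pow 2).const_mul m).add (((hd x).pow 3).const_mul n)).const_add s
    refine this.congr_deriv ?_
    norm_num
    ring
  · have := (((hd x).const_mul (2 * m)).add (((hd x).pow 2).const_mul (3 * n))).const_mul σ
    refine this.congr_deriv ?_
    norm_num
    linear_combination (2 * m + 6 * n * (σ * (x - c) + 1)) * hσ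
  · simp only [hm, hn]; ring
  · simp only [hm, hn]; linear_combination B * hσ
  · have h0 : σ * (c - σ - c) + 1 = 0 := by linear_combination -hσ
    simp only [h0]; ring
  · have h0 : σ * (c - σ - c) + 1 = 0 := by linear_combination -hσ
    simp only [h0]; ring
  · intro l r hlr ht
    have hσB : |σ * B| ≤ η := by
      have : |σ| = 1 := by
        rw [← sq_eq_sq₀ (abs_nonneg _) zero_le_one, sq_abs, hσ, one_pow]
      rw [abs_mul, this, one_mul]
      exact hB
    rw [abs_le] at hA hσB
    have key : ∀ x ∈ Ioo l r, (1 : ℝ)⁻¹ * ((s + (m * (σ * (x - c) + 1) ^ 2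
        + n * (σ * (x - c) + 1) ^ 3)) ^ 2 - 1) ^ 2
        + 1 ^ 3 * |2 * m + 6 * n * (σ * (x - c) + 1)| ^ 2 ≤ 1117 * η ^ 2 := by
      intro x hx
      obtain ⟨t0, t1⟩ := ht x hx
      have hm4 : |m| ≤ 4 * η := by rw [abs_le]; constructor <;> linarith [hA.1, hA.2, hσB.1, hσB.2]
      have hn3 : |n| ≤ 3 * η := by rw [abs_le]; constructor <;> linarith [hA.1, hA.2, hσB.1, hσB.2]
      rw [inv_one, one_mul, one_pow, one_mul]
      exact hermite_density_le hs hη0 hη hm4 hn3 t0 t1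
    calc localEnergy 1 _ _ (Ioo l r) ≤ ∫⁻ _ in Ioo l r, ENNReal.ofReal (1117 * η ^ 2) :=
          setLIntegral_mono' measurableSet_Ioo fun x hx => ENNReal.ofReal_le_ofReal (key x hx)
      _ = ENNReal.ofReal (1117 * η ^ 2) := by
          rw [setLIntegral_const, Real.volume_Ioo, hlr, ENNReal.ofReal_one, mul_one]

/-- If `U` is close to `-1` at `c` and to `1` at `d`, with small slopes, then gluing Hermite
interpolants to it on both sides yields a full transition. -/
theorem TwicePrimitive.two_mul_alpha_le_add {p : ℝ≥0∞} (hp : 1 ≤ p) {U V g : ℝ → ℝ}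
    (h : TwicePrimitive p U V g) {c d η : ℝ} (hcd : c < d) (hη : η ≤ 1 / 7)
    (hc : |U c + 1| ≤ η) (hc' : |V c| ≤ η) (hd : |U d - 1| ≤ η) (hd' : |V d| ≤ η) :
    2 * alpha p ≤ localEnergy 1 U g (Ioo c d) + ENNReal.ofReal (2234 * η ^ 2) := by
  obtain ⟨L, L₁, L₂, hL, hLc, hLc', hL0, hL0', hLE⟩ := exists_hermite p (c := c) (σ := 1) (s := -1)
    (by norm_num) (by norm_num) hη hc hc'
  obtain ⟨R, R₁, R₂, hR, hRd, hRd', hR0, hR0', hRE⟩ := exists_hermite p (c := d) (σ := -1) (s := 1)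
    (by norm_num) (by norm_num) hη hd hd'
  rw [sub_neg_eq_add] at hR0 hR0'
  have hdc : ¬ d ≤ c := not_le.2 hcd
  have hG := (hL.glue hp h (c := c) (by rw [hLc]; ring) hLc').glue hp hR (c := d)
    (by rw [if_neg hdc, hRd]; ring) (by rw [if_neg hdc, hRd'])
  have l1 : c - 1 ≤ d := by linarith
  have l2 : c - 1 ≤ c := by linarith
  have l3 : ¬ d + 1 ≤ d := by linarith
  have h1 := hG.two_mul_alpha_le hp (c := c - 1) (d := d + 1) (by linarith) one_pos
    (by rw [if_pos l1, if_pos l2, hL0]) (by rw [if_neg l3, hR0])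
    (by rw [if_pos l1, if_pos l2, hL0']) (by rw [if_neg l3, hR0'])
  refine h1.trans ?_
  rw [← localEnergy_Ioo_add (y := c) (by linarith) (by linarith),
    ← localEnergy_Ioo_add (x := c) (y := d) hcd.le (by linarith)]
  rw [localEnergy_congr (U' := L) (g' := L₂) measurableSet_Ioo
    (fun x hx => by rw [if_pos (hx.2.le.trans hcd.le), if_pos hx.2.le])
    (fun x hx => by rw [if_pos (hx.2.le.trans hcd.le), if_pos hx.2.le]),
    localEnergy_congr (U' := U) (g' := g) (S := Ioo c d) measurableSet_Ioo
    (fun x hx => by rw [if_pos hx.2.le, if_neg (not_le.2 hx.1)])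
    (fun x hx => by rw [if_pos hx.2.le, if_neg (not_le.2 hx.1)]),
    localEnergy_congr (U' := R) (g' := R₂) (S := Ioo d (d + 1)) measurableSet_Ioo
    (fun x hx => by rw [if_neg (not_le.2 hx.1)])
    (fun x hx => by rw [if_neg (not_le.2 hx.1)])]
  have e1 := hLE (c - 1) c (by ring) fun x hx => by
    constructor <;> linarith [hx.1, hx.2]
  have e2 := hRE d (d + 1) (by ring) fun x hx => by
    constructor <;> linarith [hx.1, hx.2]
  calc _ ≤ ENNReal.ofReal (1117 * η ^ 2) + (localEnergy 1 U g (Ioo c d)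
        + ENNReal.ofReal (1117 * η ^ 2)) := by gcongr
    _ = localEnergy 1 U g (Ioo c d) + ENNReal.ofReal (2234 * η ^ 2) := by
      rw [show (2234 : ℝ) * η ^ 2 = 1117 * η ^ 2 + 1117 * η ^ 2 by ring,
        ENNReal.ofReal_add (by positivity) (by positivity), add_left_comm]

theorem TwicePrimitive.two_mul_alpha_le_add_scaled {p : ℝ≥0∞} (hp : 1 ≤ p) {U V g : ℝ → ℝ}
    (h : TwicePrimitive p U V g) {c d η ε : ℝ} (hcd : c < d) (hε : 0 < ε) (hη : η ≤ 1 / 7)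
    (hc : |U c + 1| ≤ η) (hc' : |ε * V c| ≤ η) (hd : |U d - 1| ≤ η) (hd' : |ε * V d| ≤ η) :
    2 * alpha p ≤ localEnergy ε U g (Ioo c d) + ENNReal.ofReal (2234 * η ^ 2) := by
  have e : ∀ t, ε * (t / ε) + 0 = t := fun t => by field_simp; ring
  have h1 := (h.comp_affine hε 0).two_mul_alpha_le_add hp (c := c / ε) (d := d / ε) (η := η)
    (by gcongr) hη (by rwa [e]) (by rwa [e]) (by rwa [e]) (by rwa [e])
  rwa [localEnergy_comp_affine hε, one_mul, e, e] at h1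

/-- The energy between two points at which `U` is close to the values `±1` of `s`, with small
slopes, is at least `α` times the jump of `s`, up to a small error. -/
theorem TwicePrimitive.alpha_mul_edist_le {p : ℝ≥0∞} (hp : 1 ≤ p) {U V g s : ℝ → ℝ}
    (h : TwicePrimitive p U V g) {c d η ε : ℝ} (hcd : c ≤ d) (hε : 0 < ε) (hη : η ≤ 1 / 7)
    (sc : s c = -1 ∨ s c = 1) (sd : s d = -1 ∨ s d = 1)
    (hc : |U c - s c| ≤ η) (hc' : |ε * V c| ≤ η) (hd : |U d - s d| ≤ η) (hd' : |ε * V d| ≤ η) :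
    alpha p * edist (s d) (s c) ≤ localEnergy ε U g (Ioo c d) + ENNReal.ofReal (2234 * η ^ 2) := by
  rcases hcd.eq_or_lt with rfl | hcd
  · simp
  rcases sc with sc | sc <;> rcases sd with sd | sd <;> rw [sc] at hc ⊢ <;> rw [sd] at hd ⊢
  · simp
  · rw [sub_neg_eq_add] at hc
    rw [mul_comm, show edist (1 : ℝ) (-1) = 2 by rw [edist_dist, Real.dist_eq]; norm_num]
    exact h.two_mul_alpha_le_add_scaled hp hcd hε hη hc hc' hd hd'
  · rw [mul_comm, show edist (-1 : ℝ) 1 = 2 by rw [edist_dist, Real.dist_eq]; norm_num]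
    have h1 := h.neg.two_mul_alpha_le_add_scaled hp hcd hε hη
      (by rwa [neg_add_eq_sub, abs_sub_comm]) (by rwa [mul_neg, abs_neg])
      (by rw [← abs_neg]; convert hd using 2; ring) (by rwa [mul_neg, abs_neg])
    rwa [localEnergy_neg] at h1
  · simp

/-! ### Variation along a set of full measure -/

theorem exists_mem_Ioo_of_ae {a b : ℝ} {G : Set ℝ} (hG : ∀ᵐ x ∂volume.restrict (Ioo a b), x ∈ G)
    {x z : ℝ} (hax : a ≤ x) (hxz : x < z) (hzb : z ≤ b) : ∃ y ∈ Ioo x z, y ∈ G := by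
  have h1 : ∀ᵐ y ∂volume.restrict (Ioo x z), y ∈ G :=
    ae_mono (Measure.restrict_mono (Ioo_subset_Ioo hax hzb) le_rfl) hG
  have h2 : NeBot (ae (volume.restrict (Ioo x z))) := by
    rw [ae_neBot, Ne, Measure.restrict_eq_zero, Real.volume_Ioo]
    simpa using hxz
  obtain ⟨y, hy, hy'⟩ := (h1.and (ae_restrict_mem measurableSet_Ioo)).exists
  exact ⟨y, hy', hy⟩

/-- A function with values `±1` on a set `G` of full measure in `(a, b)` has a representative with
values `±1` everywhere whose variation does not exceed the variation of the function on `G`: at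
points outside `G`, take a limit value from the right along `G`. -/
theorem exists_representative_eVariationOn_le {a b : ℝ} {G : Set ℝ}
    (hG : ∀ᵐ x ∂volume.restrict (Ioo a b), x ∈ G) {u : ℝ → ℝ} (hu : ∀ x ∈ G, u x = -1 ∨ u x = 1) :
    ∃ w : ℝ → ℝ, w =ᵐ[volume.restrict (Ioo a b)] u ∧ (∀ x ∈ Ioo a b, w x = -1 ∨ w x = 1) ∧
      eVariationOn w (Ioo a b) ≤ eVariationOn u G := by
  classical
  let w : ℝ → ℝ := fun x => if x ∈ G then u x else
    if ∃ᶠ y in 𝓝[>] x, y ∈ G ∧ u y = 1 then 1 else -1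
  have key : ∀ x ∈ Ioo a b, ∀ z, x < z → ∃ y ∈ G, x ≤ y ∧ y < z ∧ u y = w x := by
    intro x hx z hxz
    by_cases hxG : x ∈ G
    · exact ⟨x, hxG, le_rfl, hxz, by simp [w, hxG]⟩
    by_cases hf : ∃ᶠ y in 𝓝[>] x, y ∈ G ∧ u y = 1
    · obtain ⟨y, ⟨hyG, hy1⟩, hy⟩ := (hf.and_eventually (Ioo_mem_nhdsGT hxz)).exists
      exact ⟨y, hyG, hy.1.le, hy.2, by simp [w, hxG, hf, hy1]⟩
    · obtain ⟨t, ht, hts⟩ := (mem_nhdsGT_iff_exists_Ioo_subset).1 (not_frequently.1 hf)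
      obtain ⟨y, hy, hyG⟩ := exists_mem_Ioo_of_ae hG hx.1.le (lt_min hxz (lt_min ht hx.2))
        ((min_le_right _ _).trans (min_le_right _ _))
      have hyt : y ∈ Ioo x t := ⟨hy.1, hy.2.trans_le ((min_le_right _ _).trans (min_le_left _ _))⟩
      have hy1 : u y = -1 := (hu y hyG).resolve_right fun h1 => hts hyt ⟨hyG, h1⟩
      exact ⟨y, hyG, hy.1.le, hy.2.trans_le (min_le_left _ _), by simp [w, hxG, hf, hy1]⟩
  refine ⟨w, ?_, fun x hx => ?_, ?_⟩
  · filter_upwards [hG] with x hx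
    simp only [w, if_pos hx]
  · obtain ⟨y, hyG, -, -, hy⟩ := key x hx (x + 1) (by linarith)
    rw [← hy]
    exact hu y hyG
  · rw [eVariationOn.eVariationOn_eq_strictMonoOn w]
    refine iSup_le ?_
    rintro ⟨n, t, ht, htm⟩
    have h1 : ∀ i ∈ Iic n, ∃ y ∈ G, t i ≤ y ∧ (∀ j ≤ n, i < j → y < t j) ∧ u y = w (t i) := by
      intro i hi
      rcases (mem_Iic.1 hi).eq_or_lt with rfl | hin
      · obtain ⟨y, hyG, h1, -, h2⟩ := key (t i) (htm i hi) (t i + 1) (by linarith)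
        exact ⟨y, hyG, h1, fun j hj hij => absurd hij (not_lt.2 hj), h2⟩
      · obtain ⟨y, hyG, h1, h2, h3⟩ := key (t i) (htm i hi) (t (i + 1))
          (ht hi (mem_Iic.2 hin) (Nat.lt_succ_self i))
        exact ⟨y, hyG, h1, fun j hj hij => h2.trans_le (ht.monotoneOn (mem_Iic.2 hin)
          (mem_Iic.2 hj) hij), h3⟩
    choose! y hyG hty hyt hyw using h1
    have hmono : MonotoneOn y (Iic n) := by
      intro i hi j hj hij
      rcases hij.eq_or_lt with rfl | hij
      · exact le_rfl
      · exact (hyt i hi j hj hij).le.trans (hty j hj)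
    refine le_trans (le_of_eq (Finset.sum_congr rfl fun i hi => ?_))
      (eVariationOn.sum_le_of_monotoneOn_Iic (f := u) (n := n) hmono fun i hi => hyG i hi)
    have hi' := Finset.mem_range.1 hi
    rw [hyw i hi'.le, hyw (i + 1) hi']

/-! ### The lower bound -/

theorem lintegral_lintegral_add_Ioo {f : ℝ → ℝ≥0∞} (hf : Measurable f) (ε : ℝ) :
    ∫⁻ x, ∫⁻ t in Ioo 0 ε, f (x + t) = ENNReal.ofReal ε * ∫⁻ x, f x := by
  rw [lintegral_lintegral_swap (by fun_prop)]
  simp only [lintegral_add_right_eq_self]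
  rw [setLIntegral_const, Real.volume_Ioo, sub_zero, mul_comm]

theorem lintegral_add_Ioo_eq (f : ℝ → ℝ≥0∞) (x ε : ℝ) :
    ∫⁻ t in Ioo 0 ε, f (x + t) = ∫⁻ y in Ioo x (x + ε), f y := by
  have h1 := (measurableEmbedding_affine one_ne_zero x).lintegral_map f
    (μ := volume.restrict (Ioo 0 ε))
  rw [map_affine_restrict_Ioo one_pos] at h1
  simpa [add_comm] using h1.symm

/-- Along a sequence with bounded energy and summable scales, almost every point is eventually
contained in an interval of length `ε_n` of small energy. -/
theorem ae_tendsto_of_localEnergy_le {p : ℝ≥0∞} {a b : ℝ} {ε : ℕ → ℝ} {U V g : ℕ → ℝ → ℝ}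
    (h : ∀ n, TwicePrimitive p (U n) (V n) (g n)) (hε : ∀ n, 0 < ε n) (hsum : Summable ε)
    {c : ℝ≥0∞} (hc : c ≠ ⊤) (hE : ∀ n, localEnergy (ε n) (U n) (g n) (Ioo a b) ≤ c) :
    ∀ᵐ x ∂volume.restrict (Ioo a b), Tendsto (fun n => ε n * V n x) atTop (𝓝 0) ∧
      Tendsto (fun n => |U n x|) atTop (𝓝 1) := by
  let d : ℕ → ℝ → ℝ≥0∞ := fun n => (Ioo a b).indicator fun x => ENNReal.ofReal
    ((ε n)⁻¹ * (U n x ^ 2 - 1) ^ 2 + ε n ^ 3 * |g n x| ^ 2)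
  have hd : ∀ n, Measurable (d n) := fun n => by
    have h1 := (h n).measurable
    have h2 := (h n).continuous.measurable
    refine Measurable.indicator ?_ measurableSet_Ioo
    fun_prop
  have hdi : ∀ n, ∫⁻ x, d n x = localEnergy (ε n) (U n) (g n) (Ioo a b) := fun n =>
    lintegral_indicator measurableSet_Ioo _
  have hem : ∀ n, Measurable fun x => ∫⁻ t in Ioo 0 (ε n), d n (x + t) := fun n => by
    have h1 := hd n
    exact Measurable.lintegral_prod_right' (f := fun q : ℝ × ℝ => d n (q.1 + q.2)) (by fun_prop)
  have hfin : ∫⁻ x, ∑' n, ∫⁻ t in Ioo 0 (ε n), d n (x + t) ≠ ⊤ := by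
    rw [lintegral_tsum fun n => (hem n).aemeasurable]
    refine ne_top_of_le_ne_top (ENNReal.mul_ne_top hsum.tsum_ofReal_ne_top hc) ?_
    rw [← ENNReal.tsum_mul_right]
    refine ENNReal.tsum_le_tsum fun n => ?_
    rw [lintegral_lintegral_add_Ioo (hd n), hdi]
    gcongr
    exact hE n
  have hae := ae_lt_top (Measurable.tsum hem) hfin
  rw [ae_restrict_iff' measurableSet_Ioo]
  filter_upwards [hae] with x hx hxm
  have h0 := ENNReal.tendsto_atTop_zero_of_tsum_ne_top hx.ne
  have hεlim := hsum.tendsto_atTop_zero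
  have key : ∀ τ : ℝ, 0 < τ → ∀ᶠ n in atTop,
      |ε n * V n x| ≤ 31 * τ ∧ |(|U n x| - 1)| ≤ 34 * τ := by
    intro τ hτ
    have h1 : ∀ᶠ n in atTop, ε n < b - x := hεlim.eventually_lt_const (sub_pos.2 hxm.2)
    have h2 : ∀ᶠ n in atTop, ∫⁻ t in Ioo 0 (ε n), d n (x + t) < ENNReal.ofReal (τ ^ 2) :=
      h0.eventually_lt_const (by simpa using pow_pos hτ 2)
    filter_upwards [h1, h2] with n h1 h2
    refine (h n).near_well_scaled (hε n) hτ (le_trans (le_of_eq ?_) h2.le)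
    rw [lintegral_add_Ioo_eq, localEnergy]
    refine setLIntegral_congr_fun measurableSet_Ioo fun y hy => ?_
    have hy' : y ∈ Ioo a b := ⟨hxm.1.trans hy.1, by linarith [hy.2]⟩
    simp only [d, indicator_of_mem hy']
  constructor
  · rw [Metric.tendsto_nhds]
    intro δ hδ
    filter_upwards [key (δ / 62) (by positivity)] with n hn
    rw [dist_zero_right, Real.norm_eq_abs]
    linarith [hn.1]
  · rw [Metric.tendsto_nhds]
    intro δ hδ
    filter_upwards [key (δ / 68) (by positivity)] with n hn
    rw [Real.dist_eq]
    linarith [hn.2]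

theorem sum_localEnergy_Ioo_le {ε : ℝ} {U g : ℝ → ℝ} {x : ℕ → ℝ} (hx : Monotone x) (N : ℕ) :
    ∑ i ∈ Finset.range N, localEnergy ε U g (Ioo (x i) (x (i + 1)))
      ≤ localEnergy ε U g (Ioo (x 0) (x N)) := by
  induction N with
  | zero => simp
  | succ N ih =>
    rw [Finset.sum_range_succ, ← localEnergy_Ioo_add (hx (Nat.zero_le N)) (hx (Nat.le_succ N))]
    gcongr

/-- The lower bound for the variation along points at which `U_n` converges to a well and the
scaled slopes tend to zero. -/
theorem alpha_mul_eVariationOn_le {p : ℝ≥0∞} (hp : 1 ≤ p) {a b : ℝ} {ε : ℕ → ℝ}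
    {U V g : ℕ → ℝ → ℝ} (h : ∀ n, TwicePrimitive p (U n) (V n) (g n)) (hε : ∀ n, 0 < ε n)
    {c : ℝ≥0∞} (hE : ∀ n, localEnergy (ε n) (U n) (g n) (Ioo a b) ≤ c) {s : ℝ → ℝ} {G : Set ℝ}
    (hGs : G ⊆ Ioo a b) (hs : ∀ x ∈ G, s x = -1 ∨ s x = 1)
    (hU : ∀ x ∈ G, Tendsto (fun n => U n x) atTop (𝓝 (s x)))
    (hV : ∀ x ∈ G, Tendsto (fun n => ε n * V n x) atTop (𝓝 0)) :
    alpha p * eVariationOn s G ≤ c := by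
  rw [eVariationOn, ENNReal.mul_iSup]
  refine iSup_le ?_
  rintro ⟨N, x, hx, hxG⟩
  dsimp only
  have key : ∀ τ ∈ Ioc (0 : ℝ) (1 / 7), alpha p * ∑ i ∈ Finset.range N,
      edist (s (x (i + 1))) (s (x i)) ≤ c + N * ENNReal.ofReal (2234 * τ ^ 2) := by
    intro τ hτ
    have h1 : ∀ᶠ n in atTop, ∀ i ∈ Finset.range (N + 1),
        |U n (x i) - s (x i)| ≤ τ ∧ |ε n * V n (x i)| ≤ τ := by
      rw [Filter.eventually_all_finset]
      intro i _
      have h2 := Metric.tendsto_nhds.1 (hU _ (hxG i)) τ hτ.1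
      have h3 := Metric.tendsto_nhds.1 (hV _ (hxG i)) τ hτ.1
      filter_upwards [h2, h3] with n h2 h3
      rw [Real.dist_eq] at h2
      rw [dist_zero_right, Real.norm_eq_abs] at h3
      exact ⟨h2.le, h3.le⟩
    obtain ⟨n, hn⟩ := h1.exists
    rw [Finset.mul_sum]
    calc ∑ i ∈ Finset.range N, alpha p * edist (s (x (i + 1))) (s (x i))
        ≤ ∑ i ∈ Finset.range N, (localEnergy (ε n) (U n) (g n) (Ioo (x i) (x (i + 1)))
            + ENNReal.ofReal (2234 * τ ^ 2)) := by
          refine Finset.sum_le_sum fun i hi => ?_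
          have hi' := Finset.mem_range.1 hi
          have e1 := hn i (Finset.mem_range.2 (by omega))
          have e2 := hn (i + 1) (Finset.mem_range.2 (by omega))
          exact (h n).alpha_mul_edist_le hp (hx (Nat.le_succ i)) (hε n) hτ.2 (hs _ (hxG _))
            (hs _ (hxG _)) e1.1 e1.2 e2.1 e2.2
      _ = ∑ i ∈ Finset.range N, localEnergy (ε n) (U n) (g n) (Ioo (x i) (x (i + 1)))
            + N * ENNReal.ofReal (2234 * τ ^ 2) := by
          rw [Finset.sum_add_distrib, Finset.sum_const, Finset.card_range, nsmul_eq_mul]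
      _ ≤ c + N * ENNReal.ofReal (2234 * τ ^ 2) := by
          gcongr
          refine (sum_localEnergy_Ioo_le hx N).trans ((localEnergy_mono ?_).trans (hE n))
          exact Ioo_subset_Ioo (hGs (hxG 0)).1.le (hGs (hxG N)).2.le
  have hlim : Tendsto (fun τ : ℝ => c + N * ENNReal.ofReal (2234 * τ ^ 2)) (𝓝[>] 0)
      (𝓝 (c + N * ENNReal.ofReal (2234 * 0 ^ 2))) := by
    have h1 : Continuous fun τ : ℝ => ENNReal.ofReal (2234 * τ ^ 2) :=
      ENNReal.continuous_ofReal.comp (by fun_prop)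
    have h2 := ((ENNReal.continuous_const_mul (ENNReal.natCast_ne_top N)).comp h1)
    exact ((continuous_const.add h2).tendsto 0).mono_left nhdsWithin_le_nhds
  have h3 := ge_of_tendsto hlim
    (Filter.mem_of_superset (Ioc_mem_nhdsGT (by norm_num : (0 : ℝ) < 1 / 7)) key)
  simpa using h3

theorem MemSobolev.of_energy_ne_top {p : ℝ≥0∞} {Ω : Set ℝ} {ε : ℝ} {u : LpOn p Ω}
    (h : energy p Ω ε u ≠ ⊤) : MemSobolev 2 p Ω u := by
  by_contra hcon
  exact h (if_neg hcon)

theorem energy_eq_localEnergy {p : ℝ≥0∞} {Ω : Set ℝ} {ε : ℝ} {u : LpOn p Ω} {U g : ℝ → ℝ}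
    (hS : MemSobolev 2 p Ω u) (hU : u =ᵐ[volume.restrict Ω] U)
    (hg : weakDeriv p Ω 2 u =ᵐ[volume.restrict Ω] g) :
    energy p Ω ε u = (localEnergy ε U g Ω : ℝ≥0∞) := by
  rw [energy, if_pos hS, localEnergy]
  congr 1
  refine lintegral_congr_ae ?_
  filter_upwards [hU, hg] with x hx hx'
  rw [hx, hx']

/-- Compactness and the lower bound, along a sequence of bounded energy. -/
theorem limitEnergy_le_of_energy_le {p : ℝ≥0∞} [Fact (1 ≤ p)] {a b : ℝ} (hab : a < b)
    {ε : ℕ → ℝ} (hε : ∀ n, 0 < ε n) (hlim : Tendsto ε atTop (𝓝 0)) {u : ℕ → LpOn p (Ioo a b)}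
    {u₀ : LpOn p (Ioo a b)} (hu : Tendsto u atTop (𝓝 u₀)) {c : ℝ≥0∞} (hc : c ≠ ⊤)
    (hE : ∀ n, energy p (Ioo a b) (ε n) (u n) ≤ (c : EReal)) :
    limitEnergy p (Ioo a b) u₀ ≤ (c : EReal) := by
  have hp : 1 ≤ p := Fact.out
  have hS : ∀ n, MemSobolev 2 p (Ioo a b) (u n) := fun n =>
    MemSobolev.of_energy_ne_top (ne_top_of_le_ne_top (by simpa using hc) (hE n))
  choose U V g h _ hU hg using fun n => (hS n).exists_twicePrimitive hp hab
  have hE' : ∀ n, localEnergy (ε n) (U n) (g n) (Ioo a b) ≤ c := fun n => by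
    have := hE n
    rw [energy_eq_localEnergy (hS n) (hU n) (hg n)] at this
    exact_mod_cast this
  -- a subsequence that converges almost everywhere and has summable scales
  obtain ⟨ns, hns, hae⟩ := (tendstoInMeasure_of_tendsto_Lp hu).exists_seq_tendsto_ae
  obtain ⟨ψ, hψ, hψε⟩ := extraction_forall_of_eventually
    (P := fun n k => ε (ns k) ≤ (1 / 2 : ℝ) ^ n) fun n =>
      ((hlim.comp hns.tendsto_atTop).eventually_lt_const (by positivity)).mono fun _ h => h.le
  have hsum : Summable fun n => ε (ns (ψ n)) :=
    Summable.of_nonneg_of_le (fun n => (hε _).le) hψε summable_geometric_two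
  have hae2 := ae_tendsto_of_localEnergy_le (fun n => h (ns (ψ n))) (fun n => hε _) hsum hc
    (fun n => hE' _)
  let G : Set ℝ := {x | x ∈ Ioo a b ∧ (u₀ x = -1 ∨ u₀ x = 1) ∧
    Tendsto (fun n => U (ns (ψ n)) x) atTop (𝓝 (u₀ x)) ∧
    Tendsto (fun n => ε (ns (ψ n)) * V (ns (ψ n)) x) atTop (𝓝 0)}
  have hG : ∀ᵐ x ∂volume.restrict (Ioo a b), x ∈ G := by
    filter_upwards [hae, hae2, ae_all_iff.2 hU, ae_restrict_mem measurableSet_Ioo]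
      with x h1 h2 h3 hx
    have h4 : Tendsto (fun n => U (ns (ψ n)) x) atTop (𝓝 (u₀ x)) := by
      simpa only [h3, Function.comp_def] using h1.comp hψ.tendsto_atTop
    refine ⟨hx, ?_, h4, h2.1⟩
    have h5 := tendsto_nhds_unique h4.abs h2.2
    exact (eq_or_eq_neg_of_abs_eq h5).symm
  have hvar := alpha_mul_eVariationOn_le hp (fun n => h (ns (ψ n))) (fun n => hε _)
    (fun n => hE' _) (s := u₀) (G := G) (fun x hx => hx.1) (fun x hx => hx.2.1)
    (fun x hx => hx.2.2.1) (fun x hx => hx.2.2.2)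
  obtain ⟨w, hwu, hw1, hwv⟩ := exists_representative_eVariationOn_le (G := G) hG
    (fun x hx => hx.2.1)
  have hfin : eVariationOn u₀ G ≠ ⊤ := fun htop => by
    rw [htop, ENNReal.mul_top (alpha_ne_zero hp)] at hvar
    exact hc (top_le_iff.1 hvar)
  rw [limitEnergy, if_pos ⟨w, hwu, ne_top_of_le_ne_top hfin hwv, hw1⟩]
  have h1 : essVar (Ioo a b) u₀ ≤ eVariationOn u₀ G := (iInf₂_le w hwu).trans hwv
  exact_mod_cast (mul_le_mul_right h1 _).trans hvar

/-! ### The upper bound -/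

theorem alpha_ne_top {p : ℝ≥0∞} (hp : 1 ≤ p) : alpha p ≠ ⊤ := by
  have hcub : TwicePrimitive p (fun x => -1 + 2 * (3 * x ^ 2 - 2 * x ^ 3))
      (fun x => 12 * (x - x ^ 2)) (fun x => 12 * (1 - 2 * x)) := by
    refine TwicePrimitive.of_continuous (fun x => ?_) (fun x => ?_) (by fun_prop)
    · refine (((((hasDerivAt_pow 2 x).const_mul 3).sub
        ((hasDerivAt_pow 3 x).const_mul 2)).const_mul 2).const_add (-1)).congr_deriv ?_
      norm_num
      ring
    · refine (((hasDerivAt_id x).sub (hasDerivAt_pow 2 x)).const_mul 12).congr_deriv ?_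
      norm_num
  have hmem := hcub.mem_family hp (by norm_num) (by norm_num) (by norm_num) (by norm_num)
  have hfin : ∀ {f : ℝ → ℝ}, Continuous f →
      ∫⁻ y in Ioo (0 : ℝ) 1, ENNReal.ofReal (f y) ≠ ⊤ := fun hf =>
    (memLp_one_iff_integrable.1 (memLp_restrict_Ioo_of_continuous hf)).lintegral_lt_top.ne
  have hPhi : Phi p (fun x => -1 + 2 * (3 * x ^ 2 - 2 * x ^ 3)) ≠ ⊤ := by
    rw [hcub.Phi_eq hp]
    exact ENNReal.mul_ne_top
      (ENNReal.rpow_ne_top_of_nonneg (by norm_num) (hfin (by fun_prop)))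
      (ENNReal.rpow_ne_top_of_nonneg (by norm_num) (hfin (by fun_prop)))
  exact ENNReal.mul_ne_top ENNReal.ofReal_ne_top (ne_top_of_le_ne_top hPhi (iInf₂_le _ hmem))

theorem IsProfile.exists_bound {p : ℝ≥0∞} {W V g : ℝ → ℝ} (h : IsProfile p W V g) :
    ∃ C, ∀ x, |W x| ≤ C := by
  obtain ⟨C, hC⟩ := (isCompact_Icc (a := (0 : ℝ)) (b := 1)).exists_bound_of_continuousOn
    h.twicePrimitive.continuous.continuousOn
  refine ⟨max C 1, fun x => ?_⟩
  rcases le_total x 0 with h0 | h0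
  · rw [h.left x h0]; simp
  rcases le_total x 1 with h1 | h1
  · exact (hC x ⟨h0, h1⟩).trans (le_max_left _ _)
  · rw [h.right x h1]; simp

/-- The superposition of copies of `F`, scaled by `k` and starting at the points `t i`, weighted by
half the increments of `s`. -/
def superpose (s t : ℕ → ℝ) (k : ℝ) (F : ℝ → ℝ) (N : ℕ) (x : ℝ) : ℝ :=
  ∑ i ∈ Finset.range N, (s (i + 1) - s i) / 2 * F (k * x + -(k * t i))

section Superpose

variable {p : ℝ≥0∞} {W V g : ℝ → ℝ} {s t : ℕ → ℝ} {k : ℝ}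

theorem IsProfile.twicePrimitive_superpose (hp : 1 ≤ p) (h : IsProfile p W V g) (hk : 0 < k)
    (N : ℕ) : TwicePrimitive p (fun x => s 0 + superpose s t k (fun y => W y + 1) N x)
      (superpose s t k (fun y => k * V y) N) (superpose s t k (fun y => k ^ 2 * g y) N) := by
  have h1 : TwicePrimitive p (superpose s t k (fun y => W y + 1) N)
      (superpose s t k (fun y => k * V y) N) (superpose s t k (fun y => k ^ 2 * g y) N) := by
    induction N with
    | zero =>
      have h0 : ∀ F, superpose s t k F 0 = fun _ => 0 := fun F => funext fun x => by
        simp [superpose]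
      simpa only [h0] using TwicePrimitive.const 0
    | succ N ih =>
      have h0 : ∀ F, superpose s t k F (N + 1) = fun x => superpose s t k F N x
          + (s (N + 1) - s N) / 2 * F (k * x + -(k * t N)) := fun F => funext fun x => by
        simp only [superpose, Finset.sum_range_succ]
      simp only [h0]
      have h2 := ((h.twicePrimitive.comp_affine hk (-(k * t N))).add hp
        (TwicePrimitive.const 1)).const_mul ((s (N + 1) - s N) / 2)
      simpa only [add_zero] using ih.add hp h2
  simpa only [zero_add] using (TwicePrimitive.const (s 0)).add hp h1

theorem superpose_eq_zero {F : ℝ → ℝ} {x : ℝ} {N : ℕ}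
    (h : ∀ i < N, F (k * x + -(k * t i)) = 0) : superpose s t k F N x = 0 :=
  Finset.sum_eq_zero fun i hi => by rw [h i (Finset.mem_range.1 hi), mul_zero]

theorem superpose_eq_sub {F : ℝ → ℝ} {x : ℝ} {N : ℕ}
    (h : ∀ i < N, F (k * x + -(k * t i)) = 2) : superpose s t k F N x = s N - s 0 := by
  rw [← Finset.sum_range_sub]
  exact Finset.sum_congr rfl fun i hi => by rw [h i (Finset.mem_range.1 hi)]; ring

theorem superpose_succ (F : ℝ → ℝ) (N : ℕ) (x : ℝ) : superpose s t k F (N + 1) x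
    = superpose s t k F N x + (s (N + 1) - s N) / 2 * F (k * x + -(k * t N)) :=
  Finset.sum_range_succ _ _

/-- If the nodes are farther apart than the width of the scaled profiles, the transitions do not
interact and the energies add up. -/
theorem IsProfile.localEnergy_superpose_le (h : IsProfile p W V g) {ε c : ℝ} {C : ℝ≥0∞}
    (hk : 0 < k) (hc : ε * k = c) (hC : localEnergy c W g (Ioo 0 1) ≤ 2 * C)
    (ht : ∀ i, 1 ≤ k * (t (i + 1) - t i)) {N : ℕ} (hs : ∀ i ≤ N, s i = -1 ∨ s i = 1) :
    localEnergy ε (fun x => s 0 + superpose s t k (fun y => W y + 1) N x)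
      (superpose s t k (fun y => k ^ 2 * g y) N) univ
      ≤ C * ∑ i ∈ Finset.range N, edist (s (i + 1)) (s i) := by
  have hmono : StrictMono t := strictMono_nat_of_lt_succ fun i => by
    have := ht i
    by_contra hcon
    nlinarith
  have hgap : ∀ {i N x}, i < N → t N ≤ x → 1 ≤ k * x + -(k * t i) := fun {i N x} hi hx => by
    have h1 := hmono.monotone (Nat.succ_le_of_lt hi)
    have h2 := ht i
    have h3 : k * (t (i + 1) - t i) ≤ k * (x - t i) := by gcongr; exact h1.trans hx
    linarith
  induction N with
  | zero =>
    rcases hs 0 le_rfl with h0 | h0 <;> simp [localEnergy, superpose, h0]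
  | succ N ih =>
    have ih' := ih fun i hi => hs i (hi.trans (Nat.le_succ N))
    have hsplit : ∀ U g : ℝ → ℝ, localEnergy ε U g univ
        = localEnergy ε U g (Iic (t N)) + localEnergy ε U g (Ioi (t N)) := fun U g => by
      simp only [localEnergy]
      rw [← Iic_union_Ioi (a := t N), lintegral_union measurableSet_Ioi]
      exact disjoint_left.2 fun x hx hx' => not_lt.2 (mem_Iic.1 hx) hx'
    rw [hsplit, Finset.sum_range_succ, mul_add]
    refine add_le_add (le_trans (le_of_eq ?_) ((localEnergy_mono
      (subset_univ (Iic (t N)))).trans ih')) ?_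
    · -- to the left of the last node, the last transition has not started
      refine localEnergy_congr measurableSet_Iic (fun x hx => ?_) (fun x hx => ?_)
      · have h0 : k * x + -(k * t N) ≤ 0 := by nlinarith [mem_Iic.1 hx]
        rw [superpose_succ, h.left _ h0]; ring
      · have h0 : k * x + -(k * t N) ≤ 0 := by nlinarith [mem_Iic.1 hx]
        rw [superpose_succ, h.eq_zero _ (fun hm => not_lt.2 h0 hm.1)]; ring
    · -- to the right of the last node, all previous transitions are completed
      have hU : ∀ x ∈ Ioi (t N), s 0 + superpose s t k (fun y => W y + 1) (N + 1) x
          = s N + (s (N + 1) - s N) / 2 * (W (k * x + -(k * t N)) + 1) := fun x hx => by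
        rw [superpose_succ, superpose_eq_sub fun i hi => by
          rw [h.right _ (hgap hi (le_of_lt hx))]; norm_num]
        ring
      have hg : ∀ x ∈ Ioi (t N), superpose s t k (fun y => k ^ 2 * g y) (N + 1) x
          = (s (N + 1) - s N) / 2 * (k ^ 2 * g (k * x + -(k * t N))) := fun x hx => by
        rw [superpose_succ, superpose_eq_zero fun i hi => by
          rw [h.eq_zero _ (fun hm => absurd hm.2 (not_lt.2 (hgap hi (le_of_lt hx)))), mul_zero]]
        ring
      rw [localEnergy_congr measurableSet_Ioi hU hg]
      have hprof : localEnergy ε (fun x => W (k * x + -(k * t N)))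
          (fun x => k ^ 2 * g (k * x + -(k * t N))) (Ioi (t N)) ≤ 2 * C := by
        have hP : Ioi (t N) ⊆ ⋃ n : ℕ, Ioo (t N) (t N + n) := fun x hx => by
          obtain ⟨n, hn⟩ := exists_nat_gt (x - t N)
          exact mem_iUnion.2 ⟨n, hx, by linarith⟩
        refine (localEnergy_mono hP).trans ?_
        rw [localEnergy, setLIntegral_iUnion_of_directed _ (Monotone.directed_le ?_)]
        · refine iSup_le fun n => ?_
          refine le_trans (le_of_eq (localEnergy_comp_affine hk _ _ _)) ?_
          rw [hc]
          exact (h.localEnergy_le _ _).trans hC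
        · intro m n hmn
          exact Ioo_subset_Ioo_right (by gcongr)
      rcases hs N (Nat.le_succ N) with h1 | h1 <;> rcases hs (N + 1) le_rfl with h2 | h2 <;>
        rw [h1, h2]
      · simp [localEnergy]
      · rw [show edist (1 : ℝ) (-1) = 2 by rw [edist_dist, Real.dist_eq]; norm_num, mul_comm C]
        refine le_trans (le_of_eq ?_) hprof
        exact localEnergy_congr measurableSet_Ioi (fun x _ => by ring) (fun x _ => by ring)
      · rw [show edist (-1 : ℝ) 1 = 2 by rw [edist_dist, Real.dist_eq]; norm_num, mul_comm C]
        refine le_trans (le_of_eq ?_) hprof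
        rw [← localEnergy_neg]
        exact localEnergy_congr measurableSet_Ioi (fun x _ => by ring) (fun x _ => by ring)
      · simp [localEnergy]

/-- The step function with values `s i` on the intervals `(t (i - 1), t i]`. -/
def stepFun (s t : ℕ → ℝ) (N : ℕ) (x : ℝ) : ℝ :=
  s 0 + ∑ i ∈ Finset.range N, (s (i + 1) - s i) * (Ioi (t i)).indicator 1 x

theorem IsProfile.tendsto_superpose (h : IsProfile p W V g) (N : ℕ) (x : ℝ) :
    Tendsto (fun k => s 0 + superpose s t k (fun y => W y + 1) N x) atTop
      (𝓝 (stepFun s t N x)) := by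
  refine tendsto_const_nhds.add (tendsto_finsetSum _ fun i _ => ?_)
  rcases le_or_gt x (t i) with hx | hx
  · refine tendsto_const_nhds.congr' ?_
    filter_upwards [eventually_ge_atTop 0] with k hk
    rw [indicator_of_notMem (notMem_Ioi.2 hx), h.left _ (by nlinarith)]
    ring
  · refine tendsto_const_nhds.congr' ?_
    filter_upwards [eventually_ge_atTop (x - t i)⁻¹] with k hk
    have h1 : 1 ≤ k * (x - t i) := by
      have h2 : 0 < x - t i := sub_pos.2 hx
      rw [← inv_mul_cancel₀ h2.ne']
      gcongr
    rw [indicator_of_mem (mem_Ioi.2 hx), h.right _ (by linarith)]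
    simp
    ring

theorem IsProfile.exists_bound_superpose (h : IsProfile p W V g) (s t : ℕ → ℝ) (N : ℕ) :
    ∃ M, ∀ k x, |s 0 + superpose s t k (fun y => W y + 1) N x| ≤ M := by
  obtain ⟨C, hC⟩ := h.exists_bound
  refine ⟨|s 0| + ∑ i ∈ Finset.range N, |(s (i + 1) - s i) / 2| * (C + 1), fun k x => ?_⟩
  refine (abs_add_le _ _).trans ?_
  gcongr
  refine (Finset.abs_sum_le_sum_abs _ _).trans (Finset.sum_le_sum fun i _ => ?_)
  rw [abs_mul]
  gcongr
  refine (abs_add_le _ _).trans ?_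
  rw [abs_one]
  gcongr
  exact hC _

theorem measurable_stepFun (N : ℕ) : Measurable (stepFun s t N) := by
  refine measurable_const.add (Finset.measurable_sum _ fun i _ => ?_)
  exact (measurable_one.indicator measurableSet_Ioi).const_mul _

/-- If `t i` lies in the `(i + 1)`-st cell of a mesh of size `h`, then the step function has at `x`
the value that is associated with a node close to `x`. -/
theorem exists_stepFun_eq {a h : ℝ} {y : ℕ → ℝ} (hy : ∀ i : ℕ, a + i * h ≤ y i)
    (hy' : ∀ i : ℕ, y i ≤ a + (i + 1) * h) (N : ℕ) {x : ℝ} (hax : a ≤ x)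
    (hx : x ≤ a + (N + 2) * h) :
    ∃ i ≤ N, stepFun s (fun i => y (i + 1)) N x = s i ∧ |y i - x| ≤ 2 * h := by
  induction N with
  | zero =>
    have h1 := hy 0
    have h2 := hy' 0
    push_cast at h1 h2 hx
    refine ⟨0, le_rfl, by simp [stepFun], ?_⟩
    rw [abs_le]
    constructor <;> linarith
  | succ N ih =>
    have h1 := hy (N + 1)
    have h2 := hy' (N + 1)
    push_cast at h1 h2 hx
    have hsucc : stepFun s (fun i => y (i + 1)) (N + 1) x = stepFun s (fun i => y (i + 1)) N x
        + (s (N + 1) - s N) * (Ioi (y (N + 1))).indicator 1 x := by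
      simp only [stepFun, Finset.sum_range_succ, add_assoc]
    rcases le_or_gt x (y (N + 1)) with hxy | hxy
    · obtain ⟨i, hi, h3, h4⟩ := ih (by linarith)
      refine ⟨i, hi.trans (Nat.le_succ N), ?_, h4⟩
      rw [hsucc, indicator_of_notMem (notMem_Ioi.2 hxy), h3]
      ring
    · refine ⟨N + 1, le_rfl, ?_, ?_⟩
      · have h5 : stepFun s (fun i => y (i + 1)) N x = s N := by
          have hm : ∀ i ∈ Finset.range N, (s (i + 1) - s i) * (Ioi (y (i + 1))).indicator 1 x
              = s (i + 1) - s i := fun i hi => by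
            have hi' : ((i : ℝ) + 1) + 1 ≤ N + 1 := by
              exact_mod_cast Nat.succ_le_succ (Finset.mem_range.1 hi)
            have h6 := hy' (i + 1)
            have h0 : 0 ≤ h := by linarith
            push_cast at h6
            have h7 : a + (i + 1 + 1) * h ≤ a + (N + 1) * h := by gcongr
            rw [indicator_of_mem (mem_Ioi.2 (by linarith)), Pi.one_apply, mul_one]
          rw [stepFun, Finset.sum_congr rfl hm, Finset.sum_range_sub]
          ring
        rw [hsucc, h5, indicator_of_mem (mem_Ioi.2 hxy), Pi.one_apply]
        ring
      · rw [abs_le]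
        constructor <;> linarith

end Superpose

/-! ### Recovery sequences -/

/-- Dominated convergence in `L^p` for uniformly bounded sequences. -/
theorem tendsto_eLpNorm_sub_of_bounded {α : Type*} [MeasurableSpace α] {μ : Measure α}
    [IsFiniteMeasure μ] {p : ℝ≥0∞} (hp : 1 ≤ p) (hp' : p ≠ ⊤) {f : ℕ → α → ℝ} {f₀ : α → ℝ} {M : ℝ}
    (hf : ∀ n, AEStronglyMeasurable (f n) μ) (hf₀ : AEStronglyMeasurable f₀ μ)
    (hM : ∀ n, ∀ᵐ x ∂μ, |f n x| ≤ M)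
    (h : ∀ᵐ x ∂μ, Tendsto (fun n => f n x) atTop (𝓝 (f₀ x))) :
    Tendsto (fun n => eLpNorm (f n - f₀) p μ) atTop (𝓝 0) := by
  have hp0 : p ≠ 0 := (one_pos.trans_le hp).ne'
  have hpr : 0 < p.toReal := ENNReal.toReal_pos hp0 hp'
  have h1 : Tendsto (fun n => ∫⁻ x, ‖f n x - f₀ x‖ₑ ^ p.toReal ∂μ) atTop
      (𝓝 (∫⁻ _, 0 ∂μ)) := by
    refine tendsto_lintegral_of_dominated_convergence'
      (fun _ => ENNReal.ofReal (M + M) ^ p.toReal) (fun n => ?_) (fun n => ?_) ?_ ?_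
    · exact ((hf n).sub hf₀).enorm.pow_const _
    · filter_upwards [hM n, h, ae_all_iff.2 hM] with x hx hlim hall
      gcongr
      have h0 : |f₀ x| ≤ M := le_of_tendsto hlim.abs (Eventually.of_forall hall)
      rw [← ofReal_norm]
      exact ENNReal.ofReal_le_ofReal ((norm_sub_le _ _).trans (add_le_add hx h0))
    · rw [lintegral_const]
      exact ENNReal.mul_ne_top (ENNReal.rpow_ne_top_of_nonneg hpr.le ENNReal.ofReal_ne_top)
        (measure_ne_top _ _)
    · filter_upwards [h] with x hx
      have h2 : Tendsto (fun n => ‖f n x - f₀ x‖ₑ) atTop (𝓝 0) := by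
        have := (hx.sub_const (f₀ x)).enorm
        simpa using this
      simpa [ENNReal.zero_rpow_of_pos hpr] using h2.ennrpow_const p.toReal
  simp_rw [eLpNorm_eq_lintegral_rpow_enorm_toReal hp0 hp', Pi.sub_apply]
  simpa [hpr] using h1.ennrpow_const (1 / p.toReal)

/-- Functions of finite variation on `(a, b)` are limits of step functions with values taken from
any prescribed set of full measure. The nodes of the step function are well separated. -/
theorem exists_tendsto_stepFun {a b : ℝ} (hab : a < b) {w : ℝ → ℝ}
    (hw : BoundedVariationOn w (Ioo a b)) {G : Set ℝ}
    (hG : ∀ᵐ x ∂volume.restrict (Ioo a b), x ∈ G) :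
    ∃ y : ℕ → ℕ → ℝ, (∀ N, ∃ γ > 0, ∀ i, γ ≤ y N (i + 1) - y N i) ∧
      (∀ N, ∀ i ≤ N, y N i ∈ G ∩ Ioo a b) ∧
      (∀ N, ∀ x ∈ Ioo a b, ∃ i ≤ N,
        stepFun (fun i => w (y N i)) (fun i => y N (i + 1)) N x = w (y N i)) ∧
      ∀ᵐ x ∂volume.restrict (Ioo a b),
        Tendsto (fun N => stepFun (fun i => w (y N i)) (fun i => y N (i + 1)) N x) atTop
          (𝓝 (w x)) := by
  have hnode : ∀ N i : ℕ, ∃ t : ℝ, a + (i + 1 / 4) * ((b - a) / (N + 1)) ≤ t ∧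
      t ≤ a + (i + 3 / 4) * ((b - a) / (N + 1)) ∧ (i ≤ N → t ∈ G ∩ Ioo a b) := by
    intro N i
    have hh : 0 < (b - a) / ((N : ℝ) + 1) := div_pos (sub_pos.2 hab) (by positivity)
    set h := (b - a) / ((N : ℝ) + 1) with hdef
    by_cases hi : i ≤ N
    · have h1 : (i : ℝ) + 3 / 4 ≤ N + 1 := by
        have : (i : ℝ) ≤ N := by exact_mod_cast hi
        linarith
      have h2 : ((N : ℝ) + 1) * h = b - a := by rw [hdef]; field_simp
      have h3 : ((i : ℝ) + 3 / 4) * h ≤ ((N : ℝ) + 1) * h := by gcongr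
      have h4 : 0 ≤ ((i : ℝ) + 1 / 4) * h := by positivity
      obtain ⟨t, ht, htG⟩ := exists_mem_Ioo_of_ae hG (x := a + (i + 1 / 4) * h)
        (z := a + (i + 3 / 4) * h) (by linarith)
        (by gcongr; norm_num) (by linarith)
      exact ⟨t, ht.1.le, ht.2.le, fun _ => ⟨htG, by linarith [ht.1], by linarith [ht.2]⟩⟩
    · exact ⟨a + (i + 1 / 4) * h, le_rfl, by gcongr; norm_num, fun h => absurd h hi⟩
  choose y hy hy' hyG using hnode
  have hstep : ∀ N, ∀ x ∈ Ioo a b, ∃ i ≤ N,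
      stepFun (fun i => w (y N i)) (fun i => y N (i + 1)) N x = w (y N i) ∧
        |y N i - x| ≤ 2 * ((b - a) / (N + 1)) := by
    intro N x hx
    have hh : 0 < (b - a) / ((N : ℝ) + 1) := div_pos (sub_pos.2 hab) (by positivity)
    have hb : b ≤ a + (N + 2) * ((b - a) / ((N : ℝ) + 1)) := by
      have h2 : ((N : ℝ) + 1) * ((b - a) / ((N : ℝ) + 1)) = b - a := by field_simp
      linarith
    exact exists_stepFun_eq (fun i => le_trans (by gcongr; norm_num) (hy N i))
      (fun i => (hy' N i).trans (by gcongr; norm_num)) N hx.1.le (hx.2.le.trans hb)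
  refine ⟨y, fun N => ⟨(b - a) / (N + 1) / 2, ?_, fun i => ?_⟩, fun N i hi => hyG N i hi,
    fun N x hx => (hstep N x hx).imp fun i h => ⟨h.1, h.2.1⟩, ?_⟩
  · have := sub_pos.2 hab
    positivity
  · have h1 := hy N (i + 1)
    have h2 := hy' N i
    push_cast at h1
    linarith
  · have hdiff := hw.locallyBoundedVariationOn.ae_differentiableWithinAt measurableSet_Ioo
    filter_upwards [hdiff, ae_restrict_mem measurableSet_Ioo] with x hx hxm
    rw [Metric.tendsto_nhds]
    intro δ hδ
    obtain ⟨η, hη, hclose⟩ := Metric.continuousWithinAt_iff.1 hx.continuousWithinAt δ hδ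
    have hmesh : Tendsto (fun N : ℕ => 2 * ((b - a) / ((N : ℝ) + 1))) atTop (𝓝 0) := by
      have := (tendsto_one_div_add_atTop_nhds_zero_nat (𝕜 := ℝ)).const_mul (2 * (b - a))
      rw [mul_zero] at this
      refine this.congr fun N => ?_
      ring
    filter_upwards [hmesh.eventually_lt_const hη] with N hN
    obtain ⟨i, hi, h1, h2⟩ := hstep N x hxm
    rw [h1]
    exact hclose (hyG N i hi).2 (by rw [Real.dist_eq]; exact h2.trans_lt hN)

/-- A diagonal argument: approximate recovery suffices. -/
theorem exists_recovery_sequence {X : Type*} [MetricSpace X] {f : ℕ → X → EReal} {x₀ : X}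
    {L : ℝ≥0∞} (h : ∀ δ : ℝ, 0 < δ → ∀ᶠ n in atTop, ∃ x, dist x x₀ < δ ∧
      f n x ≤ ((L + ENNReal.ofReal δ : ℝ≥0∞) : EReal)) :
    ∃ x : ℕ → X, Tendsto x atTop (𝓝 x₀) ∧ limsup (fun n => f n (x n)) atTop ≤ (L : EReal) := by
  classical
  let P : ℕ → ℕ → Prop := fun n k => ∃ x, dist x x₀ < 1 / ((k : ℝ) + 1) ∧
    f n x ≤ ((L + ENNReal.ofReal (1 / ((k : ℝ) + 1)) : ℝ≥0∞) : EReal)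
  have hP : ∀ k, ∀ᶠ n in atTop, P n k := fun k => h _ (by positivity)
  let x : ℕ → X := fun n => if hn : P n (Nat.findGreatest (P n) n) then hn.choose else x₀
  have key : ∀ k : ℕ, ∀ᶠ n in atTop, dist (x n) x₀ < 1 / ((k : ℝ) + 1) ∧
      f n (x n) ≤ ((L + ENNReal.ofReal (1 / ((k : ℝ) + 1)) : ℝ≥0∞) : EReal) := by
    intro k
    filter_upwards [hP k, eventually_ge_atTop k] with n hn hkn
    have h1 : P n (Nat.findGreatest (P n) n) := Nat.findGreatest_spec hkn hn
    have h2 : k ≤ Nat.findGreatest (P n) n := Nat.le_findGreatest hkn hn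
    have h3 : x n = h1.choose := dif_pos h1
    have h4 : 1 / ((Nat.findGreatest (P n) n : ℝ) + 1) ≤ 1 / ((k : ℝ) + 1) := by gcongr
    obtain ⟨h5, h6⟩ := h1.choose_spec
    rw [h3]
    refine ⟨h5.trans_le h4, h6.trans ?_⟩
    exact_mod_cast add_le_add_right (ENNReal.ofReal_le_ofReal h4) L
  refine ⟨x, ?_, ?_⟩
  · rw [Metric.tendsto_nhds]
    intro δ hδ
    obtain ⟨k, hk⟩ := exists_nat_one_div_lt hδ
    filter_upwards [key k] with n hn using hn.1.trans hk
  · have h1 : ∀ k : ℕ, limsup (fun n => f n (x n)) atTop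
        ≤ ((L + ENNReal.ofReal (1 / ((k : ℝ) + 1)) : ℝ≥0∞) : EReal) := fun k =>
      limsup_le_of_le (h := (key k).mono fun n hn => hn.2)
    have h2 : Tendsto (fun k : ℕ => ((L + ENNReal.ofReal (1 / ((k : ℝ) + 1)) : ℝ≥0∞) : EReal)) atTop
        (𝓝 ((L + ENNReal.ofReal 0 : ℝ≥0∞) : EReal)) := by
      refine (continuous_coe_ennreal_ereal.tendsto _).comp (tendsto_const_nhds.add ?_)
      exact (ENNReal.continuous_ofReal.tendsto 0).comp tendsto_one_div_add_atTop_nhds_zero_nat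
    have h3 := ge_of_tendsto' h2 h1
    simpa using h3

/-- Approximate recovery: near `u₀` there are functions with energy at most slightly more than
`α essVar u₀`. -/
theorem eventually_exists_energy_le {p : ℝ≥0∞} [Fact (1 ≤ p)] (hp' : p ≠ ⊤) {a b : ℝ} (hab : a < b)
    {ε : ℕ → ℝ} (hε : ∀ n, 0 < ε n) (hlim : Tendsto ε atTop (𝓝 0)) {u₀ : LpOn p (Ioo a b)}
    (hu₀ : MemBPV (Ioo a b) u₀) {δ : ℝ} (hδ : 0 < δ) :
    ∀ᶠ n in atTop, ∃ u : LpOn p (Ioo a b), dist u u₀ < δ ∧ energy p (Ioo a b) (ε n) u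
      ≤ ((alpha p * essVar (Ioo a b) u₀ + ENNReal.ofReal δ : ℝ≥0∞) : EReal) := by
  have hp : 1 ≤ p := Fact.out
  obtain ⟨v, hvu, hvBV, hv1⟩ := hu₀
  have hαt := alpha_ne_top hp
  have hEt : essVar (Ioo a b) u₀ ≠ ⊤ := ne_top_of_le_ne_top hvBV (iInf₂_le v hvu)
  -- a representative `w` and a profile that are optimal up to `θ`
  obtain ⟨θ, hθ0, hθ⟩ : ∃ θ : ℝ≥0∞, 0 < θ ∧
      (alpha p + θ) * (essVar (Ioo a b) u₀ + θ)
      ≤ alpha p * essVar (Ioo a b) u₀ + ENNReal.ofReal δ := by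
    set E := essVar (Ioo a b) u₀
    have hX : alpha p + E + 1 ≠ ⊤ := by simp [hαt, hEt]
    refine ⟨min 1 (ENNReal.ofReal δ / (alpha p + E + 1)), ?_, ?_⟩
    · exact lt_min one_pos (ENNReal.div_pos (by simpa using hδ) hX)
    · set θ := min 1 (ENNReal.ofReal δ / (alpha p + E + 1))
      calc (alpha p + θ) * (E + θ) = alpha p * E + θ * (alpha p + E + θ) := by ring
        _ ≤ alpha p * E + ENNReal.ofReal δ / (alpha p + E + 1) * (alpha p + E + 1) := by
            gcongr
            · exact min_le_right _ _
            · exact min_le_left _ _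
        _ ≤ alpha p * E + ENNReal.ofReal δ := by
            gcongr
            exact (ENNReal.div_mul_cancel (by simp) hX).le
  obtain ⟨w, hwu, hwE⟩ : ∃ w : ℝ → ℝ, ∃ _ : w =ᵐ[volume.restrict (Ioo a b)] u₀,
      eVariationOn w (Ioo a b) < essVar (Ioo a b) u₀ + θ := by
    have h1 : essVar (Ioo a b) u₀ < essVar (Ioo a b) u₀ + θ := ENNReal.lt_add_right hEt hθ0.ne'
    conv_lhs at h1 => rw [essVar]
    simpa only [iInf_lt_iff] using h1
  obtain ⟨W, V, g, hW, ε₀, hε₀, hcost⟩ := exists_isProfile_localEnergy_lt hp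
    (c := 2 * (alpha p + θ)) (by
      rw [mul_add]
      exact ENNReal.lt_add_right (by simp [hαt, ENNReal.mul_eq_top]) (by simpa using hθ0.ne'))
  -- a step function close to `u₀`
  have hG : ∀ᵐ x ∂volume.restrict (Ioo a b), x ∈ {x | w x = v x} := hwu.trans hvu.symm
  obtain ⟨y, hgap, hyG, hyv, hyw⟩ := exists_tendsto_stepFun hab (ne_top_of_lt hwE) hG
  have hs1 : ∀ N, ∀ i ≤ N, w (y N i) = -1 ∨ w (y N i) = 1 := fun N i hi => by
    rw [(hyG N i hi).1]
    exact hv1 _ (hyG N i hi).2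
  have hmeas : ∀ N, Measurable (stepFun (fun i => w (y N i)) (fun i => y N (i + 1)) N) := fun N =>
    measurable_stepFun N
  have hbound : ∀ N, ∀ᵐ x ∂volume.restrict (Ioo a b),
      |stepFun (fun i => w (y N i)) (fun i => y N (i + 1)) N x| ≤ 1 := by
    intro N
    filter_upwards [ae_restrict_mem measurableSet_Ioo] with x hx
    obtain ⟨i, hi, h1⟩ := hyv N x hx
    rw [h1]
    rcases hs1 N i hi with h2 | h2 <;> rw [h2] <;> simp
  have hstep : Tendsto (fun N => eLpNorm (stepFun (fun i => w (y N i)) (fun i => y N (i + 1)) N - ⇑u₀)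
      p (volume.restrict (Ioo a b))) atTop (𝓝 0) := by
    refine tendsto_eLpNorm_sub_of_bounded hp hp' (fun N => (hmeas N).aestronglyMeasurable)
      (Lp.aestronglyMeasurable u₀) hbound ?_
    filter_upwards [hyw, hwu] with x hx hx'
    rwa [← hx']
  have hδ2 : 0 < ENNReal.ofReal (δ / 2) := by simpa using hδ
  obtain ⟨N, hN⟩ := (hstep.eventually_lt_const hδ2).exists
  obtain ⟨γ, hγ, hgapN⟩ := hgap N
  have hsN := hs1 N
  have hyN := hyG N
  generalize y N = t at *
  set s : ℕ → ℝ := fun i => w (t i) with hs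
  have hmono : StrictMono t := strictMono_nat_of_lt_succ fun i => by linarith [hgapN i]
  have hvar : ∑ i ∈ Finset.range N, edist (s (i + 1)) (s i) ≤ eVariationOn w (Ioo a b) :=
    eVariationOn.sum_le_of_monotoneOn_Iic (f := w) (hmono.monotone.monotoneOn _)
      fun i hi => (hyN i hi).2
  -- the recovery sequence for the step function
  let k : ℕ → ℝ := fun n => ε₀ / ε n
  have hkpos : ∀ n, 0 < k n := fun n => div_pos hε₀ (hε n)
  have hk : Tendsto k atTop atTop := by
    have h1 : Tendsto ε atTop (𝓝[>] 0) :=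
      tendsto_nhdsWithin_iff.2 ⟨hlim, Eventually.of_forall hε⟩
    simpa only [k, div_eq_mul_inv, Pi.inv_apply] using h1.inv_tendsto_nhdsGT_zero.const_mul_atTop hε₀
  let U : ℕ → ℝ → ℝ := fun n x => s 0 + superpose s (fun i => t (i + 1)) (k n) (fun y => W y + 1) N x
  have hTP := fun n => hW.twicePrimitive_superpose hp (s := s) (t := fun i => t (i + 1)) (hkpos n) N
  have hUmem : ∀ n, MemLp (U n) p (volume.restrict (Ioo a b)) := fun n =>
    memLp_restrict_Ioo_of_continuous (hTP n).continuous
  have hUconv : Tendsto (fun n => eLpNorm (U n - stepFun s (fun i => t (i + 1)) N) p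
      (volume.restrict (Ioo a b))) atTop (𝓝 0) := by
    obtain ⟨M, hM⟩ := hW.exists_bound_superpose s (fun i => t (i + 1)) N
    refine tendsto_eLpNorm_sub_of_bounded hp hp' (fun n => (hUmem n).1)
      (measurable_stepFun N).aestronglyMeasurable (fun n => ae_of_all _ fun x => hM (k n) x) ?_
    exact ae_of_all _ fun x => (hW.tendsto_superpose N x).comp hk
  filter_upwards [hUconv.eventually_lt_const hδ2, hk.eventually_ge_atTop γ⁻¹] with n hn hkn
  have hUn : U n =ᵐ[volume.restrict (Ioo a b)] (hUmem n).toLp (U n) := (hUmem n).coeFn_toLp.symm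
  refine ⟨(hUmem n).toLp (U n), ?_, ?_⟩
  · rw [← edist_lt_ofReal, Lp.edist_def]
    have h1 : eLpNorm (⇑((hUmem n).toLp (U n)) - ⇑u₀) p (volume.restrict (Ioo a b))
        = eLpNorm ((U n - stepFun s (fun i => t (i + 1)) N)
          + (stepFun s (fun i => t (i + 1)) N - ⇑u₀)) p (volume.restrict (Ioo a b)) := by
      refine eLpNorm_congr_ae ?_
      filter_upwards [hUn] with x hx
      simp only [Pi.sub_apply, Pi.add_apply, ← hx]
      ring
    rw [h1]
    refine (eLpNorm_add_le ((hUmem n).1.sub (measurable_stepFun N).aestronglyMeasurable)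
      ((measurable_stepFun N).aestronglyMeasurable.sub (Lp.aestronglyMeasurable u₀)) hp).trans_lt ?_
    refine (ENNReal.add_lt_add hn hN).trans_le ?_
    rw [← ENNReal.ofReal_add (by positivity) (by positivity), add_halves]
  · rw [energy_eq_localEnergy ((hTP n).memSobolev hp hab hUn) hUn.symm
      ((hTP n).weakDeriv_ae_eq hp hab hUn)]
    have h1 := hW.localEnergy_superpose_le (s := s) (t := fun i => t (i + 1)) (ε := ε n) (c := ε₀)
      (C := alpha p + θ) (hkpos n) (mul_div_cancel₀ _ (hε n).ne') hcost.le (fun i => by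
        have h2 : γ⁻¹ * γ ≤ k n * (t (i + 1 + 1) - t (i + 1)) := by
          gcongr
          · exact (hkpos n).le
          · exact hgapN (i + 1)
        rwa [inv_mul_cancel₀ hγ.ne'] at h2) (N := N) hsN
    have h3 := (localEnergy_mono (subset_univ (Ioo a b))).trans h1
    have h4 : (alpha p + θ) * ∑ i ∈ Finset.range N, edist (s (i + 1)) (s i)
        ≤ (alpha p + θ) * (essVar (Ioo a b) u₀ + θ) := by
      gcongr
      exact hvar.trans hwE.le
    exact_mod_cast (h3.trans h4).trans hθ

theorem energy_nonneg {p : ℝ≥0∞} {Ω : Set ℝ} {ε : ℝ} (u : LpOn p Ω) : 0 ≤ energy p Ω ε u := by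
  unfold energy
  split_ifs
  · exact EReal.coe_ennreal_nonneg _
  · exact le_top

end PhaseTransition

theorem theorem3 (a b : ℝ) (hab : a < b) (p : ℝ≥0∞) [Fact (1 ≤ p)] (hp : p ≠ ⊤)
    (ε : ℕ → ℝ) (hε_pos : ∀ n, 0 < ε n) (hε_lim : Tendsto ε atTop (𝓝 0)) :
    PhaseTransition.GammaConverges
      (fun n => PhaseTransition.energy p (Ioo a b) (ε n))
      (PhaseTransition.limitEnergy p (Ioo a b)) := by
  intro u₀
  constructor
  · intro u hu
    refine le_of_forall_gt_imp_ge_of_dense fun c hc => ?_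
    by_cases hct : c = ⊤
    · exact hct ▸ le_top
    -- along a subsequence the energies are below `c`
    obtain ⟨φ, hφ, hφc⟩ := extraction_of_frequently_atTop
      (frequently_lt_of_liminf_lt (by isBoundedDefault) hc)
    have hc0 : 0 ≤ c := (PhaseTransition.energy_nonneg _).trans (hφc 0).le
    rw [← EReal.coe_toENNReal hc0] at hφc ⊢
    exact PhaseTransition.limitEnergy_le_of_energy_le hab (fun n => hε_pos (φ n))
      (hε_lim.comp hφ.tendsto_atTop) (hu.comp hφ.tendsto_atTop)
      (by simpa using hct) (fun n => (hφc n).le)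
  · by_cases h : PhaseTransition.MemBPV (Ioo a b) u₀
    · rw [PhaseTransition.limitEnergy, if_pos h]
      exact PhaseTransition.exists_recovery_sequence fun δ hδ =>
        PhaseTransition.eventually_exists_energy_le hp hab hε_pos hε_lim h hδ
    · rw [PhaseTransition.limitEnergy, if_neg h]
      exact ⟨fun _ => u₀, tendsto_const_nhds, le_top⟩

end
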